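/- There is an absolute constant $C > 0$ with the following property. Let $n \ge 2$, $m \ge 0$, $A \in \mathbb{R}^{m \times n}$ and $\mathbf{b} \in \mathbb{R}^m$ be such that $P = \{\mathbf{x} \in \mathbb{R}^n : A\mathbf{x} = \mathbf{b},\ \mathbf{x} \ge \mathbf{0}\}$ is a polytope (that is, $P$ is bounded) that has a vertex with a nonzero coordinate. Let $\gamma$ and $\delta_{KM}$ be the maximum and the minimum, respectively, of the nonzero values of coordinates of vertices of $P$. Let $(U, V)$ be a uniformly random pair of unit vectors in $\mathbb{R}^n$ with $U^{\intercal} V = 0$ (its law is the unique probability measure on such pairs that is invariant under the orthogonal group $O(n)$), and let $\pi(\mathbf{x}) = (U^{\intercal}\mathbf{x}, V^{\intercal}\mathbf{x})$. Then the number of vertices of the shadow $\pi(P) \subseteq \mathbb{R}^2$ is a random variable (that is, measurable up to null sets), and \[ \mathbb{E}\bigl[\,\#\{\text{vertices of } \pi(P)\}\,\bigr] \le C\, n\, \frac{\gamma}{\delta_{KM}}. \] -/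

import Mathlib

open MeasureTheory Matrix
open scoped ENNReal

noncomputable section

namespace RandomShadow

/-- The polyhedron in standard form `{x ∈ ℝⁿ : A x = b, x ≥ 0}`. -/
def standardForm {m n : ℕ} (A : Matrix (Fin m) (Fin n) ℝ) (b : Fin m → ℝ) : Set (Fin n → ℝ) :=
  {x | A *ᵥ x = b ∧ ∀ i, 0 ≤ x i}

/-- The vertices of a convex set are its extreme points. -/
abbrev vertices {E : Type*} [AddCommGroup E] [Module ℝ E] (P : Set E) : Set E :=
  P.extremePoints ℝ

/-- All nonzero values that occur as a coordinate of some vertex of `P`. -/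
def nonzeroVertexCoords {n : ℕ} (P : Set (Fin n → ℝ)) : Set ℝ :=
  {t | t ≠ 0 ∧ ∃ v ∈ vertices P, ∃ i, v i = t}

/-- The shadow of `P` under `x ↦ (uᵀ x, vᵀ x)`, a subset of the plane. -/
def shadow {n : ℕ} (P : Set (Fin n → ℝ)) (uv : (Fin n → ℝ) × (Fin n → ℝ)) : Set (ℝ × ℝ) :=
  (fun x => (uv.1 ⬝ᵥ x, uv.2 ⬝ᵥ x)) '' P

/-- The number of vertices of the shadow of `P`, as an extended nonnegative real
(infinite if there are infinitely many vertices). -/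
def shadowSize {n : ℕ} (P : Set (Fin n → ℝ)) (uv : (Fin n → ℝ) × (Fin n → ℝ)) : ℝ≥0∞ :=
  ((vertices (shadow P uv)).encard : ℝ≥0∞)

/-! The Haar probability measure of the orthogonal group `O(n)` with its usual topology. -/

instance instMeasurableSpaceOrthogonal (n : ℕ) :
    MeasurableSpace (orthogonalGroup (Fin n) ℝ) := borel _

instance instBorelSpaceOrthogonal (n : ℕ) : BorelSpace (orthogonalGroup (Fin n) ℝ) := ⟨rfl⟩

instance instCompactSpaceOrthogonal (n : ℕ) : CompactSpace (orthogonalGroup (Fin n) ℝ) := by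
  have hc : IsCompact (Set.pi Set.univ fun _ : Fin n => Set.pi Set.univ
      fun _ : Fin n => Set.Icc (-1 : ℝ) 1) :=
    isCompact_univ_pi fun _ => isCompact_univ_pi fun _ => isCompact_Icc
  refine isCompact_iff_compactSpace.mp (IsCompact.of_isClosed_subset
    (s := (Set.pi Set.univ fun _ : Fin n => Set.pi Set.univ
      fun _ : Fin n => Set.Icc (-1 : ℝ) 1)) hc ?_ ?_)
  · have h : ((orthogonalGroup (Fin n) ℝ : Submonoid (Matrix (Fin n) (Fin n) ℝ)) :
        Set (Matrix (Fin n) (Fin n) ℝ)) = {A | A * Aᵀ = 1} := by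
      ext A
      exact mem_orthogonalGroup_iff (Fin n) ℝ
    rw [h]
    exact isClosed_eq (by fun_prop) continuous_const
  · intro A hA i _ j _
    have := entry_norm_bound_of_unitary (𝕜 := ℝ) (U := A) hA i j
    exact abs_le.mp (by simpa using this)

/-- The Haar measure of `O(n)`, normalised to total mass one. -/
def haarOrthogonal (n : ℕ) : Measure (orthogonalGroup (Fin n) ℝ) :=
  Measure.haarMeasure ⊤

instance instIsProbabilityMeasureHaar (n : ℕ) : IsProbabilityMeasure (haarOrthogonal n) :=
  ⟨by
    have h := Measure.haarMeasure_self
      (K₀ := (⊤ : TopologicalSpace.PositiveCompacts (orthogonalGroup (Fin n) ℝ)))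
    simpa [haarOrthogonal] using h⟩

/-- The first two columns of an orthogonal matrix. -/
def firstTwoColumns {n : ℕ} (hn : 2 ≤ n) (g : orthogonalGroup (Fin n) ℝ) :
    (Fin n → ℝ) × (Fin n → ℝ) :=
  (g.1.col ⟨0, by omega⟩, g.1.col ⟨1, by omega⟩)

/-- The law of a uniformly random pair `(U, V)` of unit vectors of `ℝⁿ` with `Uᵀ V = 0`:
the first two columns of a Haar distributed orthogonal matrix. -/
def uniformFrame {n : ℕ} (hn : 2 ≤ n) : Measure ((Fin n → ℝ) × (Fin n → ℝ)) :=
  (haarOrthogonal n).map (firstTwoColumns hn)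

theorem measurable_firstTwoColumns {n : ℕ} (hn : 2 ≤ n) : Measurable (firstTwoColumns hn) := by
  refine Continuous.measurable ?_
  unfold firstTwoColumns Matrix.col
  have h : ∀ i j, Continuous fun g : orthogonalGroup (Fin n) ℝ => g.1 i j := fun i j =>
    (continuous_subtype_val).matrix_elem i j
  exact (continuous_pi fun i => h i _).prodMk (continuous_pi fun i => h i _)

instance instIsProbabilityMeasureFrame {n : ℕ} (hn : 2 ≤ n) :
    IsProbabilityMeasure (uniformFrame hn) :=
  Measure.isProbabilityMeasure_map (measurable_firstTwoColumns hn).aemeasurable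

/-- The pair is almost surely orthonormal. -/
theorem uniformFrame_orthonormal {n : ℕ} (hn : 2 ≤ n) :
    ∀ᵐ uv ∂uniformFrame hn,
      uv.1 ⬝ᵥ uv.1 = 1 ∧ uv.2 ⬝ᵥ uv.2 = 1 ∧ uv.1 ⬝ᵥ uv.2 = 0 := by
  refine (ae_map_iff (measurable_firstTwoColumns hn).aemeasurable ?_).2 (.of_forall fun g => ?_)
  · exact (measurableSet_eq_fun (by unfold dotProduct; fun_prop) (by fun_prop)).inter
      ((measurableSet_eq_fun (by unfold dotProduct; fun_prop) (by fun_prop)).inter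
        (measurableSet_eq_fun (by unfold dotProduct; fun_prop) (by fun_prop)))
  · have hg : g.1ᵀ * g.1 = 1 := (mem_orthogonalGroup_iff' (Fin n) ℝ).1 g.2
    have key : ∀ i j, g.1.col i ⬝ᵥ g.1.col j = (1 : Matrix (Fin n) (Fin n) ℝ) i j := by
      intro i j
      rw [← hg]
      rfl
    simp [firstTwoColumns, key]

/-- The law of the pair is invariant under every orthogonal transformation. -/
theorem uniformFrame_invariant {n : ℕ} (hn : 2 ≤ n) (h : orthogonalGroup (Fin n) ℝ) :
    (uniformFrame hn).map (fun uv => (h.1 *ᵥ uv.1, h.1 *ᵥ uv.2)) = uniformFrame hn := by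
  have hm : Measurable fun uv : (Fin n → ℝ) × (Fin n → ℝ) => (h.1 *ᵥ uv.1, h.1 *ᵥ uv.2) := by
    unfold Matrix.mulVec dotProduct
    fun_prop
  have hinv : (haarOrthogonal n).map (h * ·) = haarOrthogonal n := by
    unfold haarOrthogonal
    exact map_mul_left_eq_self _ h
  have hmul : Measurable (h * · : orthogonalGroup (Fin n) ℝ → _) :=
    (continuous_const.mul continuous_id).measurable
  unfold uniformFrame
  rw [Measure.map_map hm (measurable_firstTwoColumns hn)]
  conv_rhs => rw [← hinv, Measure.map_map (measurable_firstTwoColumns hn) hmul]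
  rfl

end RandomShadow

end

/-! The uniform frame is replaced by a pair `(c, d)` of independent Gaussian vectors (unnormalised,
so every estimate carries the total mass). Gram-Schmidt turns `(c, d)` into a uniform frame and
changes the projection only by a triangular linear map of the plane with positive diagonal, which
preserves the oriented edges of the shadow. Hence both models have the same expected edge count
(`lintegral_gaussianPair_eq_uniformFrame`).

For Gaussian pairs, the `ℓ¹` length of the boundary of the shadow is estimated in two ways.

From below: let `x ≠ y` be vertices of `P` and `e` the unit vector along `y - x`. Whether `x, y`
project to an edge does not change when the components of `c` and `d` along `e` are rescaled by a
common positive factor, since only the sign of a determinant matters and it is multiplied by that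
factor. So the event cannot force these components to be small, and given the event the projected
edge has mean length at least half of `|y - x|` (`half_lintegral_le`, `lintegral_isShadowEdge_le`).
Moreover `|y - x| ≥ δ`: some coordinate vanishes at `y` and not at `x`, because a vertex is
determined by its support (`sq_le_dotProduct_sub`).

From above: the boundary of a convex polygon is at most twice its width plus twice its height, and
coordinates of vertices lie in `[0, γ]`. The length is thus at most `4γ ∑ (|c i| + |d i|)`, with
mean at most `16 n γ` (`sum_edge_lengths_le`, `lintegral_abs_sum_le`).

Together these bound the mean number of edges by `32 n γ / δ`. Almost surely the projection is
injective on vertices and creates no collinear triples, so each vertex of the shadow starts an edge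
unless the shadow is a point. -/

namespace RandomShadow

/-! ### Oriented edges of planar point sets and the length of the boundary -/

section Planar

variable {ι : Type*}

/-- The oriented area spanned by `y - x` and `z - x` for points of the plane with coordinates
`α` and `β`. -/
def cross (α β : ι → ℝ) (x y z : ι) : ℝ :=
  (α y - α x) * (β z - β x) - (β y - β x) * (α z - α x)

/-- All points of `V` other than `x` and `y` lie strictly to the left of the line from `x`
to `y`. -/
def IsLeftEdge (V : Finset ι) (α β : ι → ℝ) (x y : ι) : Prop :=
  ∀ z ∈ V, z ≠ x → z ≠ y → 0 < cross α β x y z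

/-- Seen from `x`, all other points lie in an open half-plane; `f` is the depth into it and `g` the
coordinate along its boundary. The extreme direction, where `g / f` is largest, has everything else
on its left, strictly so because no three points involved are collinear. -/
theorem exists_isLeftEdge_of_separated (V : Finset ι) (α β : ι → ℝ) (x : ι) (a b : ℝ)
    (hV : ∃ y ∈ V, y ≠ x)
    (hsep : ∀ z ∈ V, z ≠ x → a * (α z - α x) + b * (β z - β x) < 0)
    (hcross : ∀ y ∈ V, ∀ z ∈ V, y ≠ x → z ≠ x → z ≠ y → cross α β x y z ≠ 0) :
    ∃ y ∈ V, y ≠ x ∧ IsLeftEdge V α β x y := by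
  classical
  set f : ι → ℝ := fun z => -(a * (α z - α x) + b * (β z - β x)) with hf
  set g : ι → ℝ := fun z => a * (β z - β x) - b * (α z - α x) with hg
  obtain ⟨y₀, hy₀, hy₀x⟩ := hV
  obtain ⟨y, hy, hmax⟩ := (V.filter (· ≠ x)).exists_max_image (fun z => g z / f z)
    ⟨y₀, by simp [hy₀, hy₀x]⟩
  rw [Finset.mem_filter] at hy
  refine ⟨y, hy.1, hy.2, fun z hz hzx hzy => ?_⟩
  have hfpos : ∀ w ∈ V, w ≠ x → 0 < f w := fun w hw hwx => by
    have := hsep w hw hwx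
    simp only [hf]
    linarith
  have hfy := hfpos y hy.1 hy.2
  have hfz := hfpos z hz hzx
  have hle := hmax z (by simp [hz, hzx])
  rw [div_le_div_iff₀ hfz hfy] at hle
  have hid : (a ^ 2 + b ^ 2) * cross α β x y z = g y * f z - g z * f y := by
    simp only [hf, hg, cross]
    ring
  have hab : 0 < a ^ 2 + b ^ 2 := by
    rcases eq_or_ne a 0 with rfl | ha
    · rcases eq_or_ne b 0 with rfl | hb
      · simp [hf] at hfy
      · positivity
    · positivity
  have h0 : 0 ≤ cross α β x y z := by
    by_contra hlt
    push Not at hlt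
    have := mul_neg_of_pos_of_neg hab hlt
    linarith
  exact lt_of_le_of_ne h0 (hcross y hy.1 z hz hy.2 hzx hzy).symm

theorem IsLeftEdge.cross_nonneg {V : Finset ι} {α β : ι → ℝ} {x y z : ι}
    (h : IsLeftEdge V α β x y) (hz : z ∈ V) : 0 ≤ cross α β x y z := by
  by_cases hzx : z = x
  · simp [hzx, cross]
  by_cases hzy : z = y
  · subst hzy
    simp [cross, mul_comm]
  exact (h z hz hzx hzy).le

theorem IsLeftEdge.eq_or_eq {V : Finset ι} {α β : ι → ℝ} {x y z : ι}
    (h : IsLeftEdge V α β x y) (hz : z ∈ V) (h0 : cross α β x y z ≤ 0) : z = x ∨ z = y := by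
  by_contra! hne
  exact absurd (h z hz hne.1 hne.2) (not_lt.2 h0)

/-- Height comparison of two upper edges above a common abscissa. -/
theorem IsLeftEdge.height_le {V : Finset ι} {α β : ι → ℝ} {x y x' y' : ι} {s : ℝ}
    (h : IsLeftEdge V α β x y) (hx' : x' ∈ V) (hy' : y' ∈ V)
    (h₁ : α y < s) (h₂ : s < α x) (h₁' : α y' < s) (h₂' : s < α x') :
    ((s - α y') * β x' + (α x' - s) * β y') / (α x' - α y') ≤
      ((s - α y) * β x + (α x - s) * β y) / (α x - α y) ∧
    (((s - α y') * β x' + (α x' - s) * β y') / (α x' - α y') =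
      ((s - α y) * β x + (α x - s) * β y) / (α x - α y) →
        (x' = x ∨ x' = y) ∧ (y' = x ∨ y' = y)) := by
  have hd : 0 < α x - α y := by linarith
  have hd' : 0 < α x' - α y' := by linarith
  have c₁ := h.cross_nonneg hx'
  have c₂ := h.cross_nonneg hy'
  have k₁ : 0 < s - α y' := by linarith
  have k₂ : 0 < α x' - s := by linarith
  have key : ((s - α y) * β x + (α x - s) * β y) * (α x' - α y')
      - ((s - α y') * β x' + (α x' - s) * β y') * (α x - α y)
      = (s - α y') * cross α β x y x' + (α x' - s) * cross α β x y y' := by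
    simp only [cross]
    ring
  have m₁ := mul_nonneg k₁.le c₁
  have m₂ := mul_nonneg k₂.le c₂
  constructor
  · rw [div_le_div_iff₀ hd' hd]
    linarith
  · intro he
    rw [div_eq_div_iff hd'.ne' hd.ne'] at he
    have e₁ : (s - α y') * cross α β x y x' = 0 := by linarith
    have e₂ : (α x' - s) * cross α β x y y' = 0 := by linarith
    exact ⟨h.eq_or_eq hx' ((mul_eq_zero.1 e₁).resolve_left k₁.ne').le,
      h.eq_or_eq hy' ((mul_eq_zero.1 e₂).resolve_left k₂.ne').le⟩

/-- An edge that runs leftwards has the point set below it. Over a common abscissa each of two such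
edges is at least as high as the other, so the heights agree and the edges coincide. -/
theorem IsLeftEdge.eq_of_overlap {V : Finset ι} {α β : ι → ℝ} {x y x' y' : ι} {s : ℝ}
    (h : IsLeftEdge V α β x y) (h' : IsLeftEdge V α β x' y')
    (hx : x ∈ V) (hy : y ∈ V) (hx' : x' ∈ V) (hy' : y' ∈ V)
    (h₁ : α y < s) (h₂ : s < α x) (h₁' : α y' < s) (h₂' : s < α x') : x = x' ∧ y = y' := by
  have a := h.height_le hx' hy' h₁ h₂ h₁' h₂'
  have b := h'.height_le hx hy h₁' h₂' h₁ h₂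
  obtain ⟨e₁, e₂⟩ := a.2 (le_antisymm a.1 b.1)
  constructor
  · rcases e₁ with e | e
    · exact e.symm
    · subst e; linarith
  · rcases e₂ with e | e
    · subst e; linarith
    · exact e.symm

open Classical in
/-- The horizontal extents of the upper edges add up to at most the width. -/
theorem sum_upper_le (V : Finset ι) (α β : ι → ℝ) (lo hi : ℝ)
    (hlo : ∀ z ∈ V, lo ≤ α z) (hhi : ∀ z ∈ V, α z ≤ hi) :
    ∑ p ∈ V ×ˢ V, (if IsLeftEdge V α β p.1 p.2 then ENNReal.ofReal (α p.1 - α p.2) else 0)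
      ≤ ENNReal.ofReal (hi - lo) := by
  rw [← Finset.sum_filter]
  set S := (V ×ˢ V).filter fun p => IsLeftEdge V α β p.1 p.2 with hS
  have hmem : ∀ p ∈ S, p.1 ∈ V ∧ p.2 ∈ V ∧ IsLeftEdge V α β p.1 p.2 := fun p hp => by
    simp only [hS, Finset.mem_filter, Finset.mem_product] at hp
    exact ⟨hp.1.1, hp.1.2, hp.2⟩
  -- Edges that run rightwards or vertically have an empty interval here and contribute zero through
  -- the truncation in `ENNReal.ofReal`.
  have hdisj : Set.PairwiseDisjoint (↑S) fun p : ι × ι => Set.Ioo (α p.2) (α p.1) := by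
    intro p hp q hq hpq
    refine Set.disjoint_left.2 fun s hs hs' => hpq ?_
    obtain ⟨p₁, p₂, p₃⟩ := hmem p hp
    obtain ⟨q₁, q₂, q₃⟩ := hmem q hq
    have := p₃.eq_of_overlap q₃ p₁ p₂ q₁ q₂ hs.1 hs.2 hs'.1 hs'.2
    exact Prod.ext this.1 this.2
  calc ∑ p ∈ S, ENNReal.ofReal (α p.1 - α p.2)
      = ∑ p ∈ S, volume (Set.Ioo (α p.2) (α p.1)) := by simp
    _ = volume (⋃ p ∈ S, Set.Ioo (α p.2) (α p.1)) :=
        (measure_biUnion_finset hdisj fun _ _ => measurableSet_Ioo).symm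
    _ ≤ volume (Set.Icc lo hi) := by
        refine measure_mono (Set.iUnion₂_subset fun p hp s hs => ?_)
        obtain ⟨p₁, p₂, -⟩ := hmem p hp
        exact ⟨(hlo _ p₂).trans hs.1.le, hs.2.le.trans (hhi _ p₁)⟩
    _ = ENNReal.ofReal (hi - lo) := by simp

theorem isLeftEdge_neg_right (V : Finset ι) (α β : ι → ℝ) (x y : ι) :
    IsLeftEdge V α (fun z => -β z) y x ↔ IsLeftEdge V α β x y := by
  have : ∀ z, cross α (fun z => -β z) y x z = cross α β x y z := fun z => by
    simp only [cross]; ring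
  simp only [IsLeftEdge, this]
  grind

theorem isLeftEdge_swap (V : Finset ι) (α β : ι → ℝ) (x y : ι) :
    IsLeftEdge V β α y x ↔ IsLeftEdge V α β x y := by
  have : ∀ z, cross β α y x z = cross α β x y z := fun z => by
    simp only [cross]; ring
  simp only [IsLeftEdge, this]
  grind

open Classical in
theorem sum_abs_fst_le (V : Finset ι) (α β : ι → ℝ) (lo hi : ℝ)
    (hlo : ∀ z ∈ V, lo ≤ α z) (hhi : ∀ z ∈ V, α z ≤ hi) :
    ∑ p ∈ V ×ˢ V, (if IsLeftEdge V α β p.1 p.2 then ENNReal.ofReal |α p.2 - α p.1| else 0)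
      ≤ 2 * ENNReal.ofReal (hi - lo) := by
  have h₁ := sum_upper_le V α β lo hi hlo hhi
  -- Reflection in the horizontal axis reverses orientation and exchanges lower and upper edges.
  have h₂ := sum_upper_le V α (fun z => -β z) lo hi hlo hhi
  rw [Finset.sum_product_right] at h₂
  simp only [isLeftEdge_neg_right] at h₂
  rw [← Finset.sum_product' V V
    (fun x y => if IsLeftEdge V α β x y then ENNReal.ofReal (α y - α x) else 0)] at h₂
  rw [two_mul]
  refine le_trans ?_ (add_le_add h₁ h₂)
  rw [← Finset.sum_add_distrib]
  refine Finset.sum_le_sum fun p _ => ?_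
  split_ifs
  · rcases le_total (α p.2) (α p.1) with h | h
    · rw [abs_of_nonpos (by linarith), neg_sub]
      exact le_self_add
    · rw [abs_of_nonneg (by linarith)]
      exact le_add_self
  · simp

open Classical in
theorem sum_abs_snd_le (V : Finset ι) (α β : ι → ℝ) (lo hi : ℝ)
    (hlo : ∀ z ∈ V, lo ≤ β z) (hhi : ∀ z ∈ V, β z ≤ hi) :
    ∑ p ∈ V ×ˢ V, (if IsLeftEdge V α β p.1 p.2 then ENNReal.ofReal |β p.2 - β p.1| else 0)
      ≤ 2 * ENNReal.ofReal (hi - lo) := by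
  have h := sum_abs_fst_le V β α lo hi hlo hhi
  rw [Finset.sum_product_right] at h
  simp only [isLeftEdge_swap] at h
  rw [← Finset.sum_product' V V
    (fun x y => if IsLeftEdge V α β x y then ENNReal.ofReal |β x - β y| else 0)] at h
  simpa only [abs_sub_comm] using h

end Planar

/-! ### Gaussian pairs of vectors and rescaling along a direction -/

section GaussianWeight

variable {n : ℕ}

theorem measurable_mulVec (M : Matrix (Fin n) (Fin n) ℝ) :
    Measurable fun x : Fin n → ℝ => M *ᵥ x := by
  unfold Matrix.mulVec dotProduct
  fun_prop

theorem lintegral_comp_mulVec {M : Matrix (Fin n) (Fin n) ℝ} (hM : M.det ≠ 0)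
    {f : (Fin n → ℝ) → ℝ≥0∞} (hf : Measurable f) :
    ∫⁻ x, f (M *ᵥ x) = ENNReal.ofReal |M.det⁻¹| * ∫⁻ x, f x := by
  have h := Real.map_matrix_volume_pi_eq_smul_volume_pi hM
  have h₂ : ∫⁻ x, f x ∂(Measure.map (toLin' M) volume) = ∫⁻ x, f (M *ᵥ x) := by
    rw [lintegral_map hf]
    · simp [toLin'_apply]
    · exact measurable_mulVec M
  rw [← h₂, h, lintegral_smul_measure, smul_eq_mul]

theorem lintegral_prod_comp_mulVec {M : Matrix (Fin n) (Fin n) ℝ} (hM : M.det ≠ 0)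
    {f : (Fin n → ℝ) × (Fin n → ℝ) → ℝ≥0∞} (hf : Measurable f) :
      ∫⁻ p : (Fin n → ℝ) × (Fin n → ℝ), f (M *ᵥ p.1, M *ᵥ p.2) =
      ENNReal.ofReal |M.det⁻¹| * (ENNReal.ofReal |M.det⁻¹| * ∫⁻ p, f p) := by
  have hm := measurable_mulVec M
  rw [Measure.volume_eq_prod, lintegral_prod _ (by fun_prop), lintegral_prod _ hf.aemeasurable]
  have h₁ : ∀ x : Fin n → ℝ, ∫⁻ y, f (M *ᵥ x, M *ᵥ y) =
      ENNReal.ofReal |M.det⁻¹| * ∫⁻ y, f (M *ᵥ x, y) := fun x =>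
    lintegral_comp_mulVec hM (f := fun y => f (M *ᵥ x, y)) (by fun_prop)
  simp only [h₁]
  have hI : Measurable fun x => ∫⁻ y, f (x, y) := hf.lintegral_prod_right'
  rw [lintegral_const_mul _ (f := fun x => ∫⁻ y, f (M *ᵥ x, y)) (hI.comp hm),
    lintegral_comp_mulVec hM hI]

/-- The unnormalised standard Gaussian density of a pair of vectors. -/
noncomputable def gaussianWeight (p : (Fin n → ℝ) × (Fin n → ℝ)) : ℝ≥0∞ :=
  ENNReal.ofReal (Real.exp (-(p.1 ⬝ᵥ p.1 + p.2 ⬝ᵥ p.2) / 2))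

theorem measurable_gaussianWeight : Measurable (gaussianWeight (n := n)) := by
  unfold gaussianWeight dotProduct
  fun_prop

/-- The unnormalised standard Gaussian measure on pairs of vectors. -/
noncomputable def gaussianPair (n : ℕ) : Measure ((Fin n → ℝ) × (Fin n → ℝ)) :=
  volume.withDensity gaussianWeight

theorem lintegral_gaussianPair {f : (Fin n → ℝ) × (Fin n → ℝ) → ℝ≥0∞} (hf : Measurable f) :
    ∫⁻ p, f p ∂gaussianPair n = ∫⁻ p, gaussianWeight p * f p :=
  lintegral_withDensity_eq_lintegral_mul _ measurable_gaussianWeight hf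

theorem gaussianPair_univ_ne_top : gaussianPair n Set.univ ≠ ∞ := by
  have h₁ : Integrable fun x : Fin n → ℝ => ∏ i, Real.exp (-(1 / 2) * x i ^ 2) :=
    Integrable.fintype_prod fun i => integrable_exp_neg_mul_sq (by norm_num)
  have h₂ := h₁.mul_prod h₁
  rw [gaussianPair, withDensity_apply _ MeasurableSet.univ, Measure.restrict_univ]
  rw [← Measure.volume_eq_prod] at h₂
  refine ne_of_eq_of_ne (lintegral_congr fun p => ?_) h₂.lintegral_lt_top.ne
  rw [gaussianWeight, ← Real.exp_sum, ← Real.exp_sum, ← Real.exp_add]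
  congr 2
  simp only [dotProduct, neg_mul, Finset.sum_neg_distrib, ← Finset.mul_sum, pow_two]
  ring

instance : IsFiniteMeasure (gaussianPair n) := ⟨lt_top_iff_ne_top.2 gaussianPair_univ_ne_top⟩

theorem gaussianPair_univ_ne_zero : gaussianPair n Set.univ ≠ 0 := by
  rw [gaussianPair, withDensity_apply _ MeasurableSet.univ, Measure.restrict_univ]
  refine (lintegral_pos_iff_support measurable_gaussianWeight).2 ?_ |>.ne'
  have : Function.support (gaussianWeight (n := n)) = Set.univ := by
    ext p
    simp [gaussianWeight, Real.exp_pos]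
  rw [this]
  exact isOpen_univ.measure_pos _ Set.univ_nonempty

theorem lintegral_gaussianPair_orthogonal (g : orthogonalGroup (Fin n) ℝ)
    {f : (Fin n → ℝ) × (Fin n → ℝ) → ℝ≥0∞} (hf : Measurable f) :
    ∫⁻ p, f (g.1 *ᵥ p.1, g.1 *ᵥ p.2) ∂gaussianPair n = ∫⁻ p, f p ∂gaussianPair n := by
  have hg : g.1ᵀ * g.1 = 1 := (mem_orthogonalGroup_iff' (Fin n) ℝ).1 g.2
  have hdet : |g.1.det| = 1 := by
    have h := congrArg det hg
    rw [det_mul, det_transpose, det_one] at h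
    rcases mul_self_eq_one_iff.1 h with h | h <;> simp [h]
  have hdet₀ : g.1.det ≠ 0 := by
    intro h
    simp [h] at hdet
  have hdot : ∀ x : Fin n → ℝ, (g.1 *ᵥ x) ⬝ᵥ (g.1 *ᵥ x) = x ⬝ᵥ x := fun x => by
    rw [dotProduct_mulVec, ← mulVec_transpose, mulVec_mulVec, hg, one_mulVec]
  have hm := measurable_mulVec g.1
  rw [lintegral_gaussianPair hf, lintegral_gaussianPair (by fun_prop)]
  have h := lintegral_prod_comp_mulVec hdet₀ (measurable_gaussianWeight.mul hf)
  simpa [gaussianWeight, hdot, abs_inv, hdet] using h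

/-- The linear map that multiplies the component along the unit vector `e` by `s`. -/
def stretch (s : ℝ) (e : Fin n → ℝ) : Matrix (Fin n) (Fin n) ℝ :=
  1 + replicateCol Unit ((s - 1) • e) * replicateRow Unit e

theorem det_stretch (s : ℝ) {e : Fin n → ℝ} (he : e ⬝ᵥ e = 1) : (stretch s e).det = s := by
  rw [stretch, det_one_add_replicateCol_mul_replicateRow, dotProduct_smul, he]
  simp

theorem stretch_mulVec (s : ℝ) (e x : Fin n → ℝ) :
    stretch s e *ᵥ x = x + ((s - 1) * (e ⬝ᵥ x)) • e := by
  rw [stretch, add_mulVec, one_mulVec, ← mulVec_mulVec]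
  congr 1
  ext i
  simp [mulVec, dotProduct, replicateCol, replicateRow]
  ring

theorem stretch_dotProduct_self (s : ℝ) {e : Fin n → ℝ} (he : e ⬝ᵥ e = 1) (x : Fin n → ℝ) :
    (stretch s e *ᵥ x) ⬝ᵥ (stretch s e *ᵥ x) = x ⬝ᵥ x + (s ^ 2 - 1) * (e ⬝ᵥ x) ^ 2 := by
  rw [stretch_mulVec]
  simp only [dotProduct_add, add_dotProduct, dotProduct_smul, smul_dotProduct, smul_eq_mul, he,
    dotProduct_comm x e]
  ring

/-- Change of variables by `stretch s e` in both vectors: the Jacobian is `s` for each, and the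
exponential is the ratio of the Gaussian densities. -/
theorem lintegral_gaussianPair_stretch {s : ℝ} (hs : 0 < s) {e : Fin n → ℝ} (he : e ⬝ᵥ e = 1)
    {f : (Fin n → ℝ) × (Fin n → ℝ) → ℝ≥0∞} (hf : Measurable f)
    (hinv : ∀ c d, f (stretch s e *ᵥ c, stretch s e *ᵥ d) = f (c, d)) :
    ∫⁻ p, ENNReal.ofReal (Real.exp (-(s ^ 2 - 1) * ((e ⬝ᵥ p.1) ^ 2 + (e ⬝ᵥ p.2) ^ 2) / 2)) * f p
        ∂gaussianPair n = ENNReal.ofReal ((s ^ 2)⁻¹) * ∫⁻ p, f p ∂gaussianPair n := by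
  have hdet : (stretch s e).det ≠ 0 := by
    rw [det_stretch s he]; exact hs.ne'
  have hme : Measurable fun x : Fin n → ℝ => e ⬝ᵥ x := by
    unfold dotProduct; fun_prop
  have h := lintegral_prod_comp_mulVec hdet (measurable_gaussianWeight.mul hf)
  rw [lintegral_gaussianPair hf, lintegral_gaussianPair (by fun_prop)]
  rw [det_stretch s he, ← mul_assoc, ← ENNReal.ofReal_mul (abs_nonneg _), ← abs_mul,
    ← mul_inv, ← pow_two, abs_of_pos (by positivity)] at h
  rw [Pi.mul_def] at h
  rw [← h]
  refine lintegral_congr fun p => ?_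
  beta_reduce
  rw [hinv, ← mul_assoc]
  congr 1
  rw [gaussianWeight, gaussianWeight, ← ENNReal.ofReal_mul (Real.exp_pos _).le, ← Real.exp_add]
  congr 2
  simp only [stretch_dotProduct_self s he]
  ring

theorem one_le_abs_add_exp (a b : ℝ) : 1 ≤ |a| + |b| + Real.exp (-(a ^ 2 + b ^ 2) / 2) := by
  have h := Real.add_one_le_exp (-(a ^ 2 + b ^ 2) / 2)
  have h₀ := Real.exp_pos (-(a ^ 2 + b ^ 2) / 2)
  have ha := abs_nonneg a
  have hb := abs_nonneg b
  by_cases h₁ : 1 ≤ |a| + |b|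
  · linarith
  · rw [← sq_abs a, ← sq_abs b] at *
    nlinarith

/-- A function of a Gaussian pair that ignores the length of the component along a unit vector is
positively correlated with that length. -/
theorem half_lintegral_le {e : Fin n → ℝ} (he : e ⬝ᵥ e = 1)
    {f : (Fin n → ℝ) × (Fin n → ℝ) → ℝ≥0∞} (hf : Measurable f) (hf₁ : ∀ p, f p ≤ 1)
    (hinv : ∀ c d, f (stretch √2 e *ᵥ c, stretch √2 e *ᵥ d) = f (c, d)) :
    ENNReal.ofReal (1 / 2) * ∫⁻ p, f p ∂gaussianPair n ≤
      ∫⁻ p, ENNReal.ofReal (|e ⬝ᵥ p.1| + |e ⬝ᵥ p.2|) * f p ∂gaussianPair n := by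
  have hme : Measurable fun x : Fin n → ℝ => e ⬝ᵥ x := by
    unfold dotProduct; fun_prop
  have hs := lintegral_gaussianPair_stretch (s := √2) (by positivity) he hf hinv
  have hsq : (√2 : ℝ) ^ 2 = 2 := Real.sq_sqrt (by norm_num)
  rw [hsq] at hs
  have hfin : ∫⁻ p, f p ∂gaussianPair n ≠ ∞ :=
    ((lintegral_mono hf₁).trans_lt (by simp)).ne
  -- The choice `s = √2` makes the exponential weight exactly that of `one_le_abs_add_exp`, and its
  -- integral against `f` is half the integral of `f`; that half is then cancelled, which needs
  -- finiteness.
  have hle : ∫⁻ p, f p ∂gaussianPair n ≤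
      ∫⁻ p, ENNReal.ofReal (|e ⬝ᵥ p.1| + |e ⬝ᵥ p.2|) * f p ∂gaussianPair n +
        ENNReal.ofReal (1 / 2) * ∫⁻ p, f p ∂gaussianPair n := by
    rw [one_div, ← hs, ← lintegral_add_left (by fun_prop)]
    refine lintegral_mono fun p => ?_
    rw [← add_mul, ← ENNReal.ofReal_add (by positivity) (Real.exp_pos _).le]
    refine le_mul_of_one_le_left zero_le ?_
    rw [ENNReal.one_le_ofReal]
    convert one_le_abs_add_exp (e ⬝ᵥ p.1) (e ⬝ᵥ p.2) using 3
    ring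
  set I := ∫⁻ p, f p ∂gaussianPair n
  have hI : I = ENNReal.ofReal (1 / 2) * I + ENNReal.ofReal (1 / 2) * I := by
    rw [← add_mul, ← ENNReal.ofReal_add (by norm_num) (by norm_num)]
    norm_num
  have hne : ENNReal.ofReal (1 / 2) * I ≠ ∞ := ENNReal.mul_ne_top ENNReal.ofReal_ne_top hfin
  refine (ENNReal.add_le_add_iff_right hne).1 ?_
  rw [← hI]
  exact hle

theorem abs_add_abs_le_exp (a b : ℝ) : |a| + |b| ≤ 2 * Real.exp ((a ^ 2 + b ^ 2) / 4) := by
  have h := Real.add_one_le_exp ((a ^ 2 + b ^ 2) / 4)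
  rw [← sq_abs a, ← sq_abs b] at *
  nlinarith [sq_nonneg (|a| - 1), sq_nonneg (|b| - 1)]

theorem lintegral_abs_coord_le (i : Fin n) :
    ∫⁻ p, ENNReal.ofReal (|p.1 i| + |p.2 i|) ∂gaussianPair n ≤
      ENNReal.ofReal 4 * gaussianPair n Set.univ := by
  have he : (Pi.single i 1 : Fin n → ℝ) ⬝ᵥ Pi.single i 1 = 1 := by simp
  -- Shrinking by `√2` gives the weight `exp ((a² + b²) / 4)` total integral `2` times the mass, so
  -- an exponential moment dominates the first moment.
  have h := lintegral_gaussianPair_stretch (s := (√2)⁻¹) (by positivity) he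
    (f := fun _ => 1) measurable_const (fun _ _ => rfl)
  have hsq : ((√2)⁻¹ : ℝ) ^ 2 = 1 / 2 := by
    rw [inv_pow, Real.sq_sqrt (by norm_num)]; norm_num
  rw [hsq] at h
  simp only [single_dotProduct, one_mul, mul_one, lintegral_const] at h
  have h4 : ENNReal.ofReal 4 = ENNReal.ofReal 2 * ENNReal.ofReal ((1 / 2 : ℝ)⁻¹) := by
    rw [← ENNReal.ofReal_mul (by norm_num)]
    norm_num
  rw [h4, mul_assoc, ← h, ← lintegral_const_mul _ (by fun_prop)]
  refine lintegral_mono fun p => ?_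
  rw [← ENNReal.ofReal_mul (by norm_num)]
  refine ENNReal.ofReal_le_ofReal ?_
  convert abs_add_abs_le_exp (p.1 i) (p.2 i) using 3
  ring

theorem lintegral_abs_sum_le :
    ∫⁻ p, ENNReal.ofReal (∑ i, (|p.1 i| + |p.2 i|)) ∂gaussianPair n ≤
      ENNReal.ofReal (4 * n) * gaussianPair n Set.univ := by
  calc ∫⁻ p, ENNReal.ofReal (∑ i, (|p.1 i| + |p.2 i|)) ∂gaussianPair n
      = ∑ i, ∫⁻ p, ENNReal.ofReal (|p.1 i| + |p.2 i|) ∂gaussianPair n := by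
        rw [← lintegral_finsetSum _ fun i _ => by fun_prop]
        refine lintegral_congr fun p => ENNReal.ofReal_sum_of_nonneg fun i _ => by positivity
    _ ≤ ∑ _i : Fin n, ENNReal.ofReal 4 * gaussianPair n Set.univ :=
        Finset.sum_le_sum fun i _ => lintegral_abs_coord_le i
    _ = ENNReal.ofReal (4 * n) * gaussianPair n Set.univ := by
        rw [Finset.sum_const, Finset.card_univ, Fintype.card_fin, nsmul_eq_mul, ← mul_assoc,
          mul_comm 4, ENNReal.ofReal_mul (by positivity), ENNReal.ofReal_natCast]

end GaussianWeight

/-! ### From Gaussian pairs to uniform frames -/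

section Transfer

variable {n : ℕ}

/-- The right translate of the Haar probability measure is again a Haar probability measure, and
there is only one. -/
theorem lintegral_haarOrthogonal_mul_right (h : orthogonalGroup (Fin n) ℝ)
    {f : orthogonalGroup (Fin n) ℝ → ℝ≥0∞} (hf : Measurable f) :
    ∫⁻ g, f (g * h) ∂haarOrthogonal n = ∫⁻ g, f g ∂haarOrthogonal n := by
  have hmul : Measurable (· * h : orthogonalGroup (Fin n) ℝ → _) :=
    (continuous_id.mul continuous_const).measurable
  have : (haarOrthogonal n).IsHaarMeasure := by unfold haarOrthogonal; infer_instance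
  have : IsProbabilityMeasure ((haarOrthogonal n).map (· * h)) :=
    Measure.isProbabilityMeasure_map hmul.aemeasurable
  have hmap : (haarOrthogonal n).map (· * h) = haarOrthogonal n :=
    Measure.isHaarMeasure_eq_of_isProbabilityMeasure _ _
  rw [← lintegral_map hf hmul, hmap]

theorem exists_firstTwoColumns_eq (hn : 2 ≤ n) {u v : Fin n → ℝ} (hu : u ⬝ᵥ u = 1)
    (hv : v ⬝ᵥ v = 1) (huv : u ⬝ᵥ v = 0) :
    ∃ h : orthogonalGroup (Fin n) ℝ, firstTwoColumns hn h = (u, v) := by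
  classical
  set i₀ : Fin n := ⟨0, by omega⟩
  set i₁ : Fin n := ⟨1, by omega⟩
  have hne : i₁ ≠ i₀ := by simp [i₀, i₁]
  set w : Fin n → EuclideanSpace ℝ (Fin n) := fun i =>
    if i = i₀ then WithLp.toLp 2 u else WithLp.toLp 2 v with hw
  have hinner : ∀ x y : EuclideanSpace ℝ (Fin n), inner ℝ x y = y.ofLp ⬝ᵥ x.ofLp := fun x y => by
    simp [PiLp.inner_apply, dotProduct]
  have hwo : Orthonormal ℝ (Set.domRestrict ({i₀, i₁} : Set (Fin n)) w) := by
    rw [orthonormal_iff_ite]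
    rintro ⟨i, hi⟩ ⟨j, hj⟩
    simp only [Set.domRestrict_apply, hinner, Subtype.mk.injEq]
    rcases hi with rfl | rfl <;> rcases hj with rfl | rfl <;>
      simp [hw, hne, hne.symm, hu, hv, huv, dotProduct_comm v u]
  obtain ⟨b, hb⟩ := hwo.exists_orthonormalBasis_extension_of_card_eq (by simp)
  have hb₀ : b i₀ = WithLp.toLp 2 u := by rw [hb i₀ (by simp)]; simp [hw]
  have hb₁ : b i₁ = WithLp.toLp 2 v := by rw [hb i₁ (by simp)]; simp [hw, hne]
  refine ⟨⟨Matrix.of fun i j => b j i, (mem_orthogonalGroup_iff' (Fin n) ℝ).2 ?_⟩, ?_⟩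
  · ext i j
    have := (orthonormal_iff_ite.1 b.orthonormal) j i
    rw [hinner] at this
    simp only [Matrix.mul_apply, Matrix.one_apply, Matrix.transpose_apply, Matrix.of_apply]
    rw [dotProduct] at this
    simpa [eq_comm] using this
  · ext k
    · change b i₀ k = u k
      rw [hb₀]
    · change b i₁ k = v k
      rw [hb₁]

/-- Gram-Schmidt for two vectors. -/
theorem exists_triangular (hn : 2 ≤ n) {c d : Fin n → ℝ} (hc : c ≠ 0) (hd : ∀ k : ℝ, d ≠ k • c) :
    ∃ (h : orthogonalGroup (Fin n) ℝ) (a b k : ℝ), 0 < a ∧ 0 < b ∧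
      c = a • (firstTwoColumns hn h).1 ∧
      d = b • (firstTwoColumns hn h).2 + k • (firstTwoColumns hn h).1 := by
  have hpos : ∀ x : Fin n → ℝ, x ≠ 0 → 0 < x ⬝ᵥ x := fun x hx =>
    lt_of_le_of_ne (Finset.sum_nonneg fun i _ => mul_self_nonneg _)
      fun h => hx (dotProduct_self_eq_zero.1 h.symm)
  have hcc := hpos c hc
  set k₀ := (d ⬝ᵥ c) / (c ⬝ᵥ c) with hk₀
  set e := d - k₀ • c with he
  have hee := hpos e (sub_ne_zero.2 (hd k₀))
  have hce : c ⬝ᵥ e = 0 := by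
    rw [he, dotProduct_sub, dotProduct_smul, smul_eq_mul, hk₀, div_mul_cancel₀ _ hcc.ne',
      dotProduct_comm, sub_self]
  have hsc := Real.sqrt_pos.2 hcc
  have hse := Real.sqrt_pos.2 hee
  have hunit : ∀ x : Fin n → ℝ, 0 < x ⬝ᵥ x →
      ((√(x ⬝ᵥ x))⁻¹ • x) ⬝ᵥ ((√(x ⬝ᵥ x))⁻¹ • x) = 1 := fun x hx => by
    have := Real.sqrt_pos.2 hx
    rw [dotProduct_smul, smul_dotProduct, smul_eq_mul, smul_eq_mul, ← mul_assoc, ← mul_inv,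
      Real.mul_self_sqrt hx.le, inv_mul_cancel₀ hx.ne']
  obtain ⟨h, hh⟩ := exists_firstTwoColumns_eq hn (hunit c hcc) (hunit e hee)
    (by rw [dotProduct_smul, smul_dotProduct, hce]; simp)
  refine ⟨h, √(c ⬝ᵥ c), √(e ⬝ᵥ e), k₀ * √(c ⬝ᵥ c), hsc, hse, ?_, ?_⟩
  · rw [hh, smul_smul, mul_inv_cancel₀ hsc.ne', one_smul]
  · rw [hh, smul_smul, mul_inv_cancel₀ hse.ne', one_smul, smul_smul, mul_assoc,
      mul_inv_cancel₀ hsc.ne', mul_one, he, sub_add_cancel]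

theorem ae_dotProduct_ne_zero {a : Fin n → ℝ} (ha : a ≠ 0) :
    ∀ᵐ x : Fin n → ℝ, a ⬝ᵥ x ≠ 0 := by
  rw [ae_iff]
  let S : Submodule ℝ (Fin n → ℝ) :=
    { carrier := {x | a ⬝ᵥ x = 0}
      add_mem' := fun {x y} hx hy => by
        simp only [Set.mem_ofPred_eq] at *
        rw [dotProduct_add, hx, hy, add_zero]
      zero_mem' := dotProduct_zero _
      smul_mem' := fun r x hx => by
        simp only [Set.mem_ofPred_eq] at *
        rw [dotProduct_smul, hx, smul_zero] }
  have hS : S ≠ ⊤ := fun h => ha <| dotProduct_self_eq_zero.1 <| by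
    have : a ∈ S := h ▸ Submodule.mem_top
    exact this
  convert Measure.addHaar_submodule volume S hS using 2
  ext x
  exact not_not

theorem ae_linearIndependent (hn : 2 ≤ n) :
    ∀ᵐ p : (Fin n → ℝ) × (Fin n → ℝ), p.1 ≠ 0 ∧ ∀ k : ℝ, p.2 ≠ k • p.1 := by
  set i₀ : Fin n := ⟨0, by omega⟩
  set i₁ : Fin n := ⟨1, by omega⟩
  have hne : i₁ ≠ i₀ := by simp [i₀, i₁]
  have h : ∀ᵐ p : (Fin n → ℝ) × (Fin n → ℝ), p.1 i₀ ≠ 0 ∧ p.1 i₀ * p.2 i₁ ≠ p.1 i₁ * p.2 i₀ := by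
    rw [Measure.volume_eq_prod, Measure.ae_prod_iff_ae_ae]
    · have h₀ := ae_dotProduct_ne_zero (a := Pi.single i₀ (1 : ℝ)) (by simp)
      filter_upwards [h₀] with c hc
      rw [single_one_dotProduct] at hc
      -- For fixed `c` the leading `2 × 2` minor is a linear functional of `d`, represented by this
      -- nonzero vector.
      have hv : c i₀ • Pi.single i₁ (1 : ℝ) - c i₁ • Pi.single i₀ (1 : ℝ) ≠ 0 := fun h => hc <| by
        have := congrFun h i₁
        simpa [hne] using this
      filter_upwards [ae_dotProduct_ne_zero hv] with d hd
      refine ⟨hc, fun h => hd ?_⟩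
      simp [sub_dotProduct, h]
    · have e₁ : MeasurableSet {p : (Fin n → ℝ) × (Fin n → ℝ) | p.1 i₀ ≠ 0} :=
        (measurableSet_eq_fun (by fun_prop) (by fun_prop)).compl
      have e₂ : MeasurableSet
          {p : (Fin n → ℝ) × (Fin n → ℝ) | p.1 i₀ * p.2 i₁ ≠ p.1 i₁ * p.2 i₀} :=
        (measurableSet_eq_fun (by fun_prop) (by fun_prop)).compl
      exact e₁.inter e₂
  filter_upwards [h] with p hp
  refine ⟨fun h => hp.1 (by simp [h]), fun k hk => hp.2 ?_⟩
  simp only [hk, Pi.smul_apply, smul_eq_mul]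
  ring

/-- Rotation invariance of the Gaussian measure allows averaging over `g` in `O(n)`. After Fubini, a
fixed independent pair is a triangular combination of the first two columns of some `h`; `f` ignores
the triangular part, and right invariance of Haar measure removes `h`. -/
theorem lintegral_gaussianPair_eq_uniformFrame (hn : 2 ≤ n)
    {f : (Fin n → ℝ) × (Fin n → ℝ) → ℝ≥0∞} (hf : Measurable f)
    (hinv : ∀ (c d : Fin n → ℝ) (a b k : ℝ), 0 < a → 0 < b →
      f (a • c, b • d + k • c) = f (c, d)) :
    ∫⁻ p, f p ∂gaussianPair n = gaussianPair n Set.univ * ∫⁻ p, f p ∂uniformFrame hn := by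
  have hentry : ∀ i j, Measurable fun g : orthogonalGroup (Fin n) ℝ => g.1 i j := fun i j =>
    ((continuous_subtype_val).matrix_elem i j).measurable
  have hact : Measurable fun q : ((Fin n → ℝ) × (Fin n → ℝ)) × orthogonalGroup (Fin n) ℝ =>
      (q.2.1 *ᵥ q.1.1, q.2.1 *ᵥ q.1.2) := by
    refine Measurable.prodMk ?_ ?_ <;>
    · refine measurable_pi_lambda _ fun i => ?_
      simp only [Matrix.mulVec, dotProduct]
      refine Finset.measurable_fun_sum _ fun j _ => ?_
      exact ((hentry i j).comp measurable_snd).mul (by fun_prop)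
  have hcol := measurable_firstTwoColumns hn
  have hconst : ∀ᵐ p ∂gaussianPair n,
      ∫⁻ g, f (g.1 *ᵥ p.1, g.1 *ᵥ p.2) ∂haarOrthogonal n = ∫⁻ q, f q ∂uniformFrame hn := by
    have hac : gaussianPair n ≪ volume := withDensity_absolutelyContinuous _ _
    filter_upwards [hac.ae_le (ae_linearIndependent hn)] with p hp
    obtain ⟨h, a, b, k, ha, hb, hc, hd⟩ := exists_triangular hn hp.1 hp.2
    have hg : ∀ g : orthogonalGroup (Fin n) ℝ,
        f (g.1 *ᵥ p.1, g.1 *ᵥ p.2) = f (firstTwoColumns hn (g * h)) := fun g => by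
      have e₁ : firstTwoColumns hn (g * h) =
          (g.1 *ᵥ (firstTwoColumns hn h).1, g.1 *ᵥ (firstTwoColumns hn h).2) := rfl
      rw [hc, hd, e₁, mulVec_add, mulVec_smul, mulVec_smul, mulVec_smul, hinv _ _ _ _ _ ha hb]
    simp only [hg]
    rw [lintegral_haarOrthogonal_mul_right h (f := fun g => f (firstTwoColumns hn g))
      (hf.comp hcol), uniformFrame, lintegral_map hf hcol]
  calc ∫⁻ p, f p ∂gaussianPair n
      = ∫⁻ _g, ∫⁻ p, f p ∂gaussianPair n ∂haarOrthogonal n := by simp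
    _ = ∫⁻ g, ∫⁻ p, f (g.1 *ᵥ p.1, g.1 *ᵥ p.2) ∂gaussianPair n ∂haarOrthogonal n :=
        lintegral_congr fun g => (lintegral_gaussianPair_orthogonal g hf).symm
    _ = ∫⁻ p, ∫⁻ g, f (g.1 *ᵥ p.1, g.1 *ᵥ p.2) ∂haarOrthogonal n ∂gaussianPair n :=
        (lintegral_lintegral_swap (f := fun (p : (Fin n → ℝ) × (Fin n → ℝ)) (g : orthogonalGroup (Fin n) ℝ) =>
          f (g.1 *ᵥ p.1, g.1 *ᵥ p.2)) (hf.comp hact).aemeasurable).symm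
    _ = ∫⁻ _p, ∫⁻ q, f q ∂uniformFrame hn ∂gaussianPair n := lintegral_congr_ae hconst
    _ = gaussianPair n Set.univ * ∫⁻ p, f p ∂uniformFrame hn := by
        rw [lintegral_const, mul_comm]

end Transfer

/-! ### Vertices of polytopes in standard form -/

section Vertices

variable {m n : ℕ} {A : Matrix (Fin m) (Fin n) ℝ} {b : Fin m → ℝ}

theorem convex_standardForm : Convex ℝ (standardForm A b) := by
  intro x hx y hy s t hs ht hst
  refine ⟨?_, fun i => ?_⟩
  · rw [mulVec_add, mulVec_smul, mulVec_smul, hx.1, hy.1, ← add_smul, hst, one_smul]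
  · have := mul_nonneg hs (hx.2 i)
    have := mul_nonneg ht (hy.2 i)
    simp only [Pi.add_apply, Pi.smul_apply, smul_eq_mul]
    linarith

theorem isClosed_standardForm : IsClosed (standardForm A b) := by
  have h : standardForm A b = {x | A *ᵥ x = b} ∩ ⋂ i, {x | 0 ≤ x i} := by
    ext x
    simp [standardForm]
  rw [h]
  exact (isClosed_eq (continuous_const.matrix_mulVec continuous_id) continuous_const).inter
    (isClosed_iInter fun i => isClosed_le continuous_const (continuous_apply i))

/-- A vertex of a polyhedron in standard form is the only point supported on its support. -/
theorem eq_of_support_subset {x y : Fin n → ℝ} (hx : x ∈ standardForm A b)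
    (hy : y ∈ vertices (standardForm A b)) (h : ∀ i, y i = 0 → x i = 0) : x = y := by
  have hyP := hy.1
  have hev : ∀ᶠ t : ℝ in nhdsWithin 0 (Set.Ioi 0), ∀ i, 0 ≤ y i + t * (y i - x i) := by
    refine Filter.eventually_all.2 fun i => ?_
    rcases (hyP.2 i).eq_or_lt with h0 | h0
    · refine Filter.Eventually.of_forall fun t => ?_
      rw [h i h0.symm, ← h0]
      simp
    · have hc : Filter.Tendsto (fun t : ℝ => y i + t * (y i - x i)) (nhdsWithin 0 (Set.Ioi 0))
          (nhds (y i + 0 * (y i - x i))) :=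
        (Continuous.tendsto (by fun_prop) 0).mono_left nhdsWithin_le_nhds
      refine (hc.eventually (lt_mem_nhds (a := 0) (by simpa using h0))).mono fun t ht => ?_
      exact le_of_lt ht
  obtain ⟨t, ht, htpos⟩ := (hev.and self_mem_nhdsWithin).exists
  have htpos : 0 < t := htpos
  -- The segment from `x` extends slightly beyond `y` inside the polyhedron, so extremality of `y`
  -- forces `x = y`.
  have hz : y + t • (y - x) ∈ standardForm A b := by
    refine ⟨?_, fun i => by simpa using ht i⟩
    rw [mulVec_add, mulVec_smul, mulVec_sub, hyP.1, hx.1, sub_self, smul_zero, add_zero]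
  refine (mem_extremePoints.1 hy).2 _ hx _ hz ⟨t / (1 + t), 1 / (1 + t), by positivity,
    by positivity, by field_simp; ring, ?_⟩ |>.1
  ext i
  simp only [Pi.add_apply, Pi.smul_apply, Pi.sub_apply, smul_eq_mul]
  field_simp
  ring

theorem finite_vertices : (vertices (standardForm A b)).Finite := by
  refine Set.Finite.of_finite_image (f := fun x => {i | x i = 0}) (Set.toFinite _) ?_
  intro x hx y hy hxy
  refine eq_of_support_subset hx.1 hy fun i hi => ?_
  have : i ∈ {i | x i = 0} := by
    simp only at hxy
    rw [hxy]
    exact hi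
  exact this

theorem convexHull_vertices (hb : Bornology.IsBounded (standardForm A b)) :
    convexHull ℝ (vertices (standardForm A b)) = standardForm A b := by
  have hc : IsCompact (standardForm A b) := Metric.isCompact_of_isClosed_isBounded
    isClosed_standardForm hb
  have h := closure_convexHull_extremePoints hc convex_standardForm
  rwa [(finite_vertices.isClosed_convexHull ℝ).closure_eq] at h

theorem sq_le_dotProduct_sub {δ : ℝ} (hδ₀ : 0 ≤ δ)
    (hδ : δ ∈ lowerBounds (nonzeroVertexCoords (standardForm A b))) {x y : Fin n → ℝ}
    (hx : x ∈ vertices (standardForm A b)) (hy : y ∈ vertices (standardForm A b)) (hxy : x ≠ y) :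
    δ ^ 2 ≤ (y - x) ⬝ᵥ (y - x) := by
  obtain ⟨i, hi, hi'⟩ : ∃ i, y i = 0 ∧ x i ≠ 0 := by
    by_contra! h
    exact hxy (eq_of_support_subset hx.1 hy h)
  have h₁ : δ ≤ x i := hδ ⟨hi', x, hx, i, rfl⟩
  have h₂ : (y - x) i * (y - x) i ≤ (y - x) ⬝ᵥ (y - x) :=
    Finset.single_le_sum (f := fun i => (y - x) i * (y - x) i)
      (fun _ _ => mul_self_nonneg _) (Finset.mem_univ i)
  rw [Pi.sub_apply, hi] at h₂
  nlinarith

theorem extremePoints_not_collinear {E : Type*} [AddCommGroup E] [Module ℝ E] {P : Set E}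
    {x y z : E} (hx : x ∈ P.extremePoints ℝ) (hy : y ∈ P.extremePoints ℝ)
    (hz : z ∈ P.extremePoints ℝ) (hxy : x ≠ y) (hxz : x ≠ z) (hyz : y ≠ z) (s : ℝ) :
    z - x ≠ s • (y - x) := by
  intro h
  have hz' : z = x + s • (y - x) := by rw [← h]; abel
  rcases lt_trichotomy s 0 with hs | rfl | hs
  · refine hxy.symm ((mem_extremePoints.1 hx).2 y hy.1 z hz.1
      ⟨-s / (1 - s), 1 / (1 - s), div_pos (by linarith) (by linarith),
        div_pos one_pos (by linarith), ?_, ?_⟩).1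
    · have : (1 - s) ≠ 0 := by linarith
      field_simp
      ring
    · have : (1 - s) ≠ 0 := by linarith
      rw [hz']
      match_scalars <;> field_simp <;> ring
  · exact hxz (by simpa using hz'.symm)
  rcases lt_trichotomy s 1 with hs₁ | rfl | hs₁
  · refine hxz ((mem_extremePoints.1 hz).2 x hx.1 y hy.1
      ⟨1 - s, s, by linarith, hs, by ring, ?_⟩).1
    rw [hz']
    module
  · exact hyz (by simpa using hz'.symm)
  · refine hxy ((mem_extremePoints.1 hy).2 x hx.1 z hz.1
      ⟨(s - 1) / s, 1 / s, div_pos (by linarith) hs, by positivity, by field_simp; ring, ?_⟩).1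
    rw [hz']
    match_scalars <;> field_simp <;> ring

end Vertices

/-! ### Extreme points of the hull of a finite set -/

section ConvexHull

variable {E : Type*} [AddCommGroup E] [Module ℝ E] [TopologicalSpace E] [IsTopologicalAddGroup E]
  [ContinuousSMul ℝ E] [LocallyConvexSpace ℝ E] [T2Space E]

/-- For the reverse direction: if `q` is not extreme, all extreme points lie in `S \ {q}`, and by
Krein-Milman their hull already contains `q`. -/
theorem mem_extremePoints_convexHull_iff {S : Set E} (hS : S.Finite) {q : E} (hq : q ∈ S) :
    q ∈ (convexHull ℝ S).extremePoints ℝ ↔ q ∉ convexHull ℝ (S \ {q}) := by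
  constructor
  · intro h
    have := ((convex_convexHull ℝ S).mem_extremePoints_iff_mem_sdiff_convexHull_sdiff.1 h).2
    exact fun h' => this (convexHull_mono (Set.sdiff_subset_sdiff_left (subset_convexHull ℝ S)) h')
  · intro h
    by_contra hne
    have hsub : (convexHull ℝ S).extremePoints ℝ ⊆ S \ {q} := fun p hp =>
      ⟨extremePoints_convexHull_subset hp, fun h' => hne (by
        rw [Set.mem_singleton_iff] at h'
        rwa [← h'])⟩
    have hcl := closure_convexHull_extremePoints (hS.isCompact_convexHull ℝ)
      (convex_convexHull ℝ S)
    rw [((hS.subset (hsub.trans Set.sdiff_subset)).isClosed_convexHull ℝ).closure_eq] at hcl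
    refine h (convexHull_mono hsub ?_)
    rw [hcl]
    exact subset_convexHull ℝ S hq

end ConvexHull

/-! ### Edges of the shadow and their invariances -/

section Shadow

variable {n : ℕ}

/-- The projection to the plane spanned by a pair of vectors. -/
def proj (p : (Fin n → ℝ) × (Fin n → ℝ)) (x : Fin n → ℝ) : ℝ × ℝ := (p.1 ⬝ᵥ x, p.2 ⬝ᵥ x)

theorem isLinearMap_proj (p : (Fin n → ℝ) × (Fin n → ℝ)) : IsLinearMap ℝ (proj p) :=
  ⟨fun x y => by simp [proj, dotProduct_add], fun r x => by simp [proj, dotProduct_smul]⟩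

theorem shadow_convexHull (V : Set (Fin n → ℝ)) (p : (Fin n → ℝ) × (Fin n → ℝ)) :
    shadow (convexHull ℝ V) p = convexHull ℝ (proj p '' V) :=
  (isLinearMap_proj p).image_convexHull V

/-- The pair `(x, y)` projects to an edge of the shadow that has all other points of `V` on its
left. -/
def IsShadowEdge (V : Finset (Fin n → ℝ)) (p : (Fin n → ℝ) × (Fin n → ℝ)) (x y : Fin n → ℝ) :
    Prop :=
  IsLeftEdge V (fun z => p.1 ⬝ᵥ z) (fun z => p.2 ⬝ᵥ z) x y

/-- The projection is injective on `V`, and no three points of `V` become collinear. -/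
def IsGeneric (V : Finset (Fin n → ℝ)) (p : (Fin n → ℝ) × (Fin n → ℝ)) : Prop :=
  (∀ x ∈ V, ∀ y ∈ V, x ≠ y → proj p x ≠ proj p y) ∧
  ∀ x ∈ V, ∀ y ∈ V, ∀ z ∈ V, x ≠ y → x ≠ z → y ≠ z →
    cross (fun w => p.1 ⬝ᵥ w) (fun w => p.2 ⬝ᵥ w) x y z ≠ 0

/-- The number of oriented edges of the shadow of `V`. -/
noncomputable def edgeCount (V : Finset (Fin n → ℝ)) (p : (Fin n → ℝ) × (Fin n → ℝ)) : ℝ≥0∞ :=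
  ∑ q ∈ V.offDiag, {p | IsShadowEdge V p q.1 q.2}.indicator 1 p

theorem exists_isShadowEdge {V : Finset (Fin n → ℝ)} {p : (Fin n → ℝ) × (Fin n → ℝ)}
    (hp : IsGeneric V p) {x : Fin n → ℝ} (hx : x ∈ V)
    (hext : proj p x ∈ vertices (convexHull ℝ (proj p '' V))) (hV : ∃ y ∈ V, y ≠ x) :
    ∃ y ∈ V, y ≠ x ∧ IsShadowEdge V p x y := by
  have hfin : (proj p '' (V : Set (Fin n → ℝ))).Finite := V.finite_toSet.image _
  have hnot := (mem_extremePoints_convexHull_iff hfin (Set.mem_image_of_mem _ hx)).1 hext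
  obtain ⟨f, u, hf, hu⟩ := geometric_hahn_banach_closed_point (convex_convexHull ℝ _)
    ((hfin.subset Set.sdiff_subset).isClosed_convexHull ℝ) hnot
  have hlin : ∀ z : ℝ × ℝ, f z = f (1, 0) * z.1 + f (0, 1) * z.2 := fun z => by
    have : z = z.1 • ((1, 0) : ℝ × ℝ) + z.2 • ((0, 1) : ℝ × ℝ) := by ext <;> simp
    conv_lhs => rw [this, map_add, map_smul, map_smul]
    simp only [smul_eq_mul]
    ring
  refine exists_isLeftEdge_of_separated V _ _ x (f (1, 0)) (f (0, 1)) hV ?_ ?_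
  · intro z hz hzx
    have h₁ := hf (proj p z) (subset_convexHull ℝ _
      ⟨Set.mem_image_of_mem _ hz, hp.1 z hz x hx hzx⟩)
    have h₂ := h₁.trans hu
    rw [hlin, hlin (proj p x)] at h₂
    simp only [proj] at h₂
    linarith
  · exact fun y hy z hz hyx hzx hzy => hp.2 x hx y hy z hz hyx.symm hzx.symm hzy.symm

theorem shadowSize_le {V : Finset (Fin n → ℝ)} {p : (Fin n → ℝ) × (Fin n → ℝ)}
    (hp : IsGeneric V p) : shadowSize (convexHull ℝ V) p ≤ 1 + edgeCount V p := by
  classical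
  rw [shadowSize, shadow_convexHull]
  have hsub : vertices (convexHull ℝ (proj p '' (V : Set (Fin n → ℝ)))) ⊆ proj p '' V :=
    extremePoints_convexHull_subset
  by_cases hV : ∃ x ∈ V, ∃ y ∈ V, y ≠ x
  · refine le_trans ?_ le_add_self
    set W := V.offDiag.filter fun q => IsShadowEdge V p q.1 q.2 with hW
    have h₁ : vertices (convexHull ℝ (proj p '' (V : Set (Fin n → ℝ)))) ⊆
        ↑(W.image fun q => proj p q.1) := by
      intro q hq
      obtain ⟨x, hx, rfl⟩ := hsub hq
      have hVx : ∃ y ∈ V, y ≠ x := by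
        obtain ⟨a, ha, b, hb, hab⟩ := hV
        by_cases hax : a = x
        · exact ⟨b, hb, hax ▸ hab⟩
        · exact ⟨a, ha, hax⟩
      obtain ⟨y, hy, hyx, he⟩ := exists_isShadowEdge hp hx hq hVx
      simp only [Finset.coe_image, Set.mem_image, Finset.mem_coe]
      refine ⟨(x, y), ?_, rfl⟩
      simp only [hW, Finset.mem_filter, Finset.mem_offDiag]
      exact ⟨⟨hx, hy, hyx.symm⟩, he⟩
    have h₂ : (vertices (convexHull ℝ (proj p '' (V : Set (Fin n → ℝ))))).encard ≤ W.card := by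
      refine (Set.encard_le_encard h₁).trans ?_
      rw [Set.encard_coe_eq_coe_finsetCard]
      exact_mod_cast Finset.card_image_le
    have h₃ : edgeCount V p = (W.card : ℝ≥0∞) := by
      rw [edgeCount, hW, Finset.card_filter, Nat.cast_sum]
      refine Finset.sum_congr rfl fun q _ => ?_
      by_cases h : IsShadowEdge V p q.1 q.2 <;> simp [h]
    rw [h₃]
    exact_mod_cast h₂
  -- With at most one point there are no edges; the summand `1` pays for the single vertex.
  · refine le_trans ?_ le_self_add
    push Not at hV
    have : (vertices (convexHull ℝ (proj p '' (V : Set (Fin n → ℝ))))).encard ≤ 1 := by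
      rw [Set.encard_le_one_iff]
      intro a b ha hb
      obtain ⟨x, hx, rfl⟩ := hsub ha
      obtain ⟨y, hy, rfl⟩ := hsub hb
      rw [hV x hx y hy]
    exact_mod_cast this

theorem measurableSet_isShadowEdge (V : Finset (Fin n → ℝ)) (x y : Fin n → ℝ) :
    MeasurableSet {p | IsShadowEdge V p x y} := by
  have h : {p | IsShadowEdge V p x y} = ⋂ z ∈ V, {p : (Fin n → ℝ) × (Fin n → ℝ) |
      z ≠ x → z ≠ y → 0 < cross (fun w => p.1 ⬝ᵥ w) (fun w => p.2 ⬝ᵥ w) x y z} := by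
    ext p
    simp [IsShadowEdge, IsLeftEdge]
  rw [h]
  refine Finset.measurableSet_biInter _ fun z _ => ?_
  by_cases hzx : z = x
  · simp [hzx]
  by_cases hzy : z = y
  · simp [hzy]
  simp only [ne_eq, hzx, hzy, not_false_eq_true, forall_const]
  unfold cross dotProduct
  exact measurableSet_lt (by fun_prop) (by fun_prop)

theorem measurable_edgeCount (V : Finset (Fin n → ℝ)) : Measurable (edgeCount V) :=
  Finset.measurable_fun_sum _ fun q _ =>
    measurable_one.indicator (measurableSet_isShadowEdge V q.1 q.2)

theorem measurableSet_isGeneric (V : Finset (Fin n → ℝ)) : MeasurableSet {p | IsGeneric V p} := by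
  have h : {p | IsGeneric V p} =
      (⋂ x ∈ V, ⋂ y ∈ V, {p | x ≠ y → proj p x ≠ proj p y}) ∩
      ⋂ x ∈ V, ⋂ y ∈ V, ⋂ z ∈ V, {p | x ≠ y → x ≠ z → y ≠ z →
        cross (fun w => p.1 ⬝ᵥ w) (fun w => p.2 ⬝ᵥ w) x y z ≠ 0} := by
    ext p
    simp [IsGeneric]
  rw [h]
  refine MeasurableSet.inter ?_ ?_
  · refine Finset.measurableSet_biInter _ fun x _ => Finset.measurableSet_biInter _ fun y _ => ?_
    by_cases hxy : x = y
    · simp [hxy]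
    · simp only [ne_eq, hxy, not_false_eq_true, forall_const]
      refine (measurableSet_eq_fun ?_ ?_).compl <;>
      · unfold proj dotProduct
        fun_prop
  · refine Finset.measurableSet_biInter _ fun x _ => Finset.measurableSet_biInter _ fun y _ =>
      Finset.measurableSet_biInter _ fun z _ => ?_
    by_cases hd : x ≠ y ∧ x ≠ z ∧ y ≠ z
    · simp only [ne_eq, hd.1, hd.2.1, hd.2.2, not_false_eq_true, forall_const]
      refine (measurableSet_eq_fun ?_ measurable_const).compl
      unfold cross dotProduct
      fun_prop
    · convert MeasurableSet.univ using 1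
      ext p
      simp only [Set.mem_ofPred_eq, Set.mem_univ, iff_true]
      exact fun h₁ h₂ h₃ => absurd ⟨h₁, h₂, h₃⟩ hd

theorem cross_triangular (c d : Fin n → ℝ) (a b k : ℝ) (x y z : Fin n → ℝ) :
    cross (fun w => (a • c) ⬝ᵥ w) (fun w => (b • d + k • c) ⬝ᵥ w) x y z =
      a * b * cross (fun w => c ⬝ᵥ w) (fun w => d ⬝ᵥ w) x y z := by
  simp only [cross, smul_dotProduct, add_dotProduct, smul_eq_mul]
  ring

theorem isShadowEdge_triangular (V : Finset (Fin n → ℝ)) (c d : Fin n → ℝ) {a b : ℝ} (k : ℝ)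
    (ha : 0 < a) (hb : 0 < b) (x y : Fin n → ℝ) :
    IsShadowEdge V (a • c, b • d + k • c) x y ↔ IsShadowEdge V (c, d) x y := by
  simp only [IsShadowEdge, IsLeftEdge, cross_triangular, mul_pos_iff_of_pos_left (mul_pos ha hb)]

theorem edgeCount_triangular (V : Finset (Fin n → ℝ)) (c d : Fin n → ℝ) {a b : ℝ} (k : ℝ)
    (ha : 0 < a) (hb : 0 < b) : edgeCount V (a • c, b • d + k • c) = edgeCount V (c, d) := by
  refine Finset.sum_congr rfl fun q _ => ?_
  by_cases h : IsShadowEdge V (c, d) q.1 q.2 <;>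
    simp [h, isShadowEdge_triangular V c d k ha hb]

theorem isGeneric_triangular (V : Finset (Fin n → ℝ)) (c d : Fin n → ℝ) {a b : ℝ} (k : ℝ)
    (ha : 0 < a) (hb : 0 < b) : IsGeneric V (a • c, b • d + k • c) ↔ IsGeneric V (c, d) := by
  have h₁ : ∀ x y, proj (a • c, b • d + k • c) x = proj (a • c, b • d + k • c) y ↔
      proj (c, d) x = proj (c, d) y := fun x y => by
    simp only [proj, Prod.mk.injEq, smul_dotProduct, add_dotProduct, smul_eq_mul]
    constructor
    · rintro ⟨e₁, e₂⟩
      have e₁ := mul_left_cancel₀ ha.ne' e₁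
      rw [e₁, add_left_inj] at e₂
      exact ⟨e₁, mul_left_cancel₀ hb.ne' e₂⟩
    · rintro ⟨e₁, e₂⟩
      rw [e₁, e₂]
      exact ⟨rfl, rfl⟩
  have hab : a * b ≠ 0 := (mul_pos ha hb).ne'
  simp only [IsGeneric, ne_eq, h₁, cross_triangular, mul_eq_zero, hab, false_or]

/-- `cross` is the 2-form `c ∧ d` on `(y - x, z - x)`. The symmetric map `stretch s e` can be moved
onto these arguments: it multiplies `y - x` by `s` and changes `z - x` only by a multiple of `e`,
which the form does not see. -/
theorem cross_stretch (s r : ℝ) {e x y : Fin n → ℝ} (he : e ⬝ᵥ e = 1) (hxy : y - x = r • e)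
    (c d z : Fin n → ℝ) :
    cross (fun w => (stretch s e *ᵥ c) ⬝ᵥ w) (fun w => (stretch s e *ᵥ d) ⬝ᵥ w) x y z =
      s * cross (fun w => c ⬝ᵥ w) (fun w => d ⬝ᵥ w) x y z := by
  have hy : y = x + r • e := by rw [← hxy]; abel
  simp only [cross, hy, stretch_mulVec, add_dotProduct, smul_dotProduct, dotProduct_add,
    dotProduct_smul, smul_eq_mul, he, dotProduct_comm e c, dotProduct_comm e d]
  ring

theorem isShadowEdge_stretch (V : Finset (Fin n → ℝ)) {s r : ℝ} (hs : 0 < s)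
    {e x y : Fin n → ℝ} (he : e ⬝ᵥ e = 1) (hxy : y - x = r • e) (c d : Fin n → ℝ) :
    IsShadowEdge V (stretch s e *ᵥ c, stretch s e *ᵥ d) x y ↔ IsShadowEdge V (c, d) x y := by
  simp only [IsShadowEdge, IsLeftEdge, cross_stretch s r he hxy, mul_pos_iff_of_pos_left hs]

end Shadow

/-! ### Almost sure genericity and measurability -/

section Generic

variable {n : ℕ}

theorem ae_isGeneric_volume {V : Finset (Fin n → ℝ)}
    (hV : ∀ x ∈ V, ∀ y ∈ V, ∀ z ∈ V, x ≠ y → x ≠ z → y ≠ z → ∀ s : ℝ, z - x ≠ s • (y - x)) :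
    ∀ᵐ p : (Fin n → ℝ) × (Fin n → ℝ), IsGeneric V p := by
  rw [Measure.volume_eq_prod, Measure.ae_prod_iff_ae_ae (measurableSet_isGeneric V)]
  have h₁ : ∀ᵐ c : Fin n → ℝ, ∀ x ∈ V, ∀ y ∈ V, x ≠ y → (y - x) ⬝ᵥ c ≠ 0 := by
    refine (ae_ball_iff V.countable_toSet).2 fun x _ => (ae_ball_iff V.countable_toSet).2
      fun y _ => ?_
    by_cases hxy : x = y
    · simp [hxy]
    · filter_upwards [ae_dotProduct_ne_zero (sub_ne_zero.2 (Ne.symm hxy))] with c hc _ using hc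
  filter_upwards [h₁] with c hc
  have h₂ : ∀ᵐ d : Fin n → ℝ, ∀ x ∈ V, ∀ y ∈ V, ∀ z ∈ V, x ≠ y → x ≠ z → y ≠ z →
      cross (fun w => c ⬝ᵥ w) (fun w => d ⬝ᵥ w) x y z ≠ 0 := by
    refine (ae_ball_iff V.countable_toSet).2 fun x hx => (ae_ball_iff V.countable_toSet).2
      fun y hy => (ae_ball_iff V.countable_toSet).2 fun z hz => ?_
    by_cases hd : x ≠ y ∧ x ≠ z ∧ y ≠ z
    · have hcy := hc x hx y hy hd.1
      -- For fixed `c` the determinant is the linear functional of `d` given by this vector, which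
      -- vanishes only if `x, y, z` are collinear.
      have hne : ((y - x) ⬝ᵥ c) • (z - x) - ((z - x) ⬝ᵥ c) • (y - x) ≠ 0 := fun h => by
        refine hV x hx y hy z hz hd.1 hd.2.1 hd.2.2 (((z - x) ⬝ᵥ c) / ((y - x) ⬝ᵥ c)) ?_
        rw [div_eq_inv_mul, mul_smul, ← sub_eq_zero.1 h, smul_smul, inv_mul_cancel₀ hcy, one_smul]
      filter_upwards [ae_dotProduct_ne_zero hne] with d hd' _ _ _ h0
      refine hd' (Eq.trans ?_ h0)
      simp only [cross, smul_eq_mul, dotProduct_comm _ c, dotProduct_comm _ d, dotProduct_sub,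
        dotProduct_smul]
      ring
    · exact Filter.Eventually.of_forall fun d h₁ h₂ h₃ => absurd ⟨h₁, h₂, h₃⟩ hd
  filter_upwards [h₂] with d hd
  refine ⟨fun x hx y hy hxy h => hc x hx y hy hxy ?_, hd⟩
  have := congrArg Prod.fst h
  simp only [proj] at this
  rw [dotProduct_comm, dotProduct_sub, this, sub_self]

theorem ae_isGeneric_uniformFrame (hn : 2 ≤ n) {V : Finset (Fin n → ℝ)}
    (hV : ∀ x ∈ V, ∀ y ∈ V, ∀ z ∈ V, x ≠ y → x ≠ z → y ≠ z → ∀ s : ℝ, z - x ≠ s • (y - x)) :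
    ∀ᵐ p ∂uniformFrame hn, IsGeneric V p := by
  have hms := (measurableSet_isGeneric V).compl
  have hac : gaussianPair n ≪ volume := withDensity_absolutelyContinuous _ _
  have h := lintegral_gaussianPair_eq_uniformFrame hn
    (f := {p | IsGeneric V p}ᶜ.indicator 1) (measurable_one.indicator hms) (by
      intro c d a b k ha hb
      by_cases h : IsGeneric V (c, d) <;> simp [h, isGeneric_triangular V c d k ha hb])
  rw [lintegral_indicator_one hms, lintegral_indicator_one hms] at h
  have h0 : gaussianPair n {p | IsGeneric V p}ᶜ = 0 := hac.ae_le (ae_isGeneric_volume hV)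
  rw [h0, eq_comm, mul_eq_zero] at h
  exact h.resolve_left gaussianPair_univ_ne_zero

/-- The set is the image of a closed set under projection along the compact factor `convexHull ℝ S`.
It makes the vertex count a finite sum of measurable indicators on generic pairs. -/
theorem isClosed_proj_mem_convexHull {S : Set (Fin n → ℝ)} (hS : S.Finite) (x : Fin n → ℝ) :
    IsClosed {p | proj p x ∈ convexHull ℝ (proj p '' S)} := by
  have : CompactSpace (convexHull ℝ S) :=
    isCompact_iff_compactSpace.1 (hS.isCompact_convexHull ℝ)
  have hcl : IsClosed {q : convexHull ℝ S × ((Fin n → ℝ) × (Fin n → ℝ)) |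
      proj q.2 q.1.1 = proj q.2 x} := by
    have hx : Continuous fun q : convexHull ℝ S × ((Fin n → ℝ) × (Fin n → ℝ)) => q.1.1 :=
      continuous_subtype_val.comp continuous_fst
    unfold proj
    exact isClosed_eq (by fun_prop) (by fun_prop)
  convert isClosedMap_snd_of_compactSpace _ hcl using 1
  ext p
  rw [Set.mem_ofPred_eq, ← (isLinearMap_proj p).image_convexHull]
  constructor
  · rintro ⟨w, hw, he⟩
    exact ⟨(⟨w, hw⟩, p), he, rfl⟩
  · rintro ⟨⟨w, p'⟩, he, rfl⟩
    exact ⟨w.1, w.2, he⟩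

theorem shadowSize_eq_sum {V : Finset (Fin n → ℝ)} {p : (Fin n → ℝ) × (Fin n → ℝ)}
    (hp : IsGeneric V p) : shadowSize (convexHull ℝ V) p =
      ∑ x ∈ V, {p | proj p x ∈ convexHull ℝ (proj p '' (↑V \ {x}))}ᶜ.indicator 1 p := by
  classical
  have hinj : Set.InjOn (proj p) V := fun x hx y hy h => by
    by_contra hne
    exact hp.1 x hx y hy hne h
  have hext : ∀ x ∈ V, proj p x ∈ vertices (convexHull ℝ (proj p '' (V : Set (Fin n → ℝ)))) ↔
      proj p x ∉ convexHull ℝ (proj p '' (↑V \ {x})) := fun x hx => by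
    have himg : proj p '' (↑V \ {x}) = proj p '' V \ {proj p x} := by
      rw [hinj.image_sdiff_subset (by simpa using hx), Set.image_singleton]
    rw [himg]
    exact mem_extremePoints_convexHull_iff (V.finite_toSet.image _) (Set.mem_image_of_mem _ hx)
  set W := V.filter fun x => proj p x ∉ convexHull ℝ (proj p '' (↑V \ {x})) with hW
  have hv : vertices (convexHull ℝ (proj p '' (V : Set (Fin n → ℝ)))) = proj p '' W := by
    ext q
    constructor
    · intro hq
      obtain ⟨x, hx, rfl⟩ := extremePoints_convexHull_subset hq
      exact Set.mem_image_of_mem _ (by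
        rw [hW, Finset.coe_filter]
        exact ⟨hx, (hext x hx).1 hq⟩)
    · rintro ⟨x, hx, rfl⟩
      rw [hW, Finset.coe_filter] at hx
      exact (hext x hx.1).2 hx.2
  rw [shadowSize, shadow_convexHull, hv, Set.InjOn.encard_image (hinj.mono (by simp only [hW]; exact Finset.coe_subset.2 (Finset.filter_subset _ _))),
    Set.encard_coe_eq_coe_finsetCard, ENat.toENNReal_coe, hW, Finset.card_filter, Nat.cast_sum]
  refine Finset.sum_congr rfl fun x _ => ?_
  by_cases h : proj p x ∈ convexHull ℝ (proj p '' (↑V \ {x})) <;> simp [h]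

theorem aemeasurable_shadowSize (hn : 2 ≤ n) {V : Finset (Fin n → ℝ)}
    (hV : ∀ x ∈ V, ∀ y ∈ V, ∀ z ∈ V, x ≠ y → x ≠ z → y ≠ z → ∀ s : ℝ, z - x ≠ s • (y - x)) :
    AEMeasurable (shadowSize (convexHull ℝ V)) (uniformFrame hn) := by
  refine ⟨fun p => ∑ x ∈ V,
    {p | proj p x ∈ convexHull ℝ (proj p '' (↑V \ {x}))}ᶜ.indicator 1 p, ?_, ?_⟩
  · exact Finset.measurable_fun_sum _ fun x _ => measurable_one.indicator
      (isClosed_proj_mem_convexHull (V.finite_toSet.subset Set.sdiff_subset) x).measurableSet.compl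
  · filter_upwards [ae_isGeneric_uniformFrame hn hV] with p hp using shadowSize_eq_sum hp

end Generic

/-! ### The two estimates of the boundary length -/

section Bound

variable {n : ℕ}

theorem sum_edge_lengths_le {V : Finset (Fin n → ℝ)} {γ : ℝ}
    (hV₀ : ∀ x ∈ V, ∀ i, 0 ≤ x i) (hV₁ : ∀ x ∈ V, ∀ i, x i ≤ γ) (hγ : 0 ≤ γ)
    (p : (Fin n → ℝ) × (Fin n → ℝ)) :
    ∑ q ∈ V.offDiag, ENNReal.ofReal (|(q.2 - q.1) ⬝ᵥ p.1| + |(q.2 - q.1) ⬝ᵥ p.2|) *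
        {p | IsShadowEdge V p q.1 q.2}.indicator 1 p ≤
      ENNReal.ofReal (4 * γ) * ENNReal.ofReal (∑ i, (|p.1 i| + |p.2 i|)) := by
  classical
  -- The extent in direction `c` is therefore at most `2γ ∑ |c i|`; counting upper and lower edges
  -- doubles this, whence the `4γ`.
  have hb : ∀ (c : Fin n → ℝ), ∀ z ∈ V, |c ⬝ᵥ z| ≤ γ * ∑ i, |c i| := fun c z hz => by
    rw [Finset.mul_sum]
    refine (Finset.abs_sum_le_sum_abs _ _).trans (Finset.sum_le_sum fun i _ => ?_)
    rw [abs_mul, abs_of_nonneg (hV₀ z hz i), mul_comm]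
    exact mul_le_mul_of_nonneg_right (hV₁ z hz i) (abs_nonneg _)
  have h₁ := sum_abs_fst_le V (fun z => p.1 ⬝ᵥ z) (fun z => p.2 ⬝ᵥ z) _ _
    (fun z hz => (abs_le.1 (hb p.1 z hz)).1) (fun z hz => (abs_le.1 (hb p.1 z hz)).2)
  have h₂ := sum_abs_snd_le V (fun z => p.1 ⬝ᵥ z) (fun z => p.2 ⬝ᵥ z) _ _
    (fun z hz => (abs_le.1 (hb p.2 z hz)).1) (fun z hz => (abs_le.1 (hb p.2 z hz)).2)
  have hsub : V.offDiag ⊆ V ×ˢ V := fun q hq => by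
    rw [Finset.mem_offDiag] at hq
    exact Finset.mem_product.2 ⟨hq.1, hq.2.1⟩
  refine (Finset.sum_le_sum_of_subset hsub).trans ?_
  calc _ = ∑ q ∈ V ×ˢ V, ((if IsLeftEdge V (fun z => p.1 ⬝ᵥ z) (fun z => p.2 ⬝ᵥ z) q.1 q.2 then
          ENNReal.ofReal |p.1 ⬝ᵥ q.2 - p.1 ⬝ᵥ q.1| else 0) +
        (if IsLeftEdge V (fun z => p.1 ⬝ᵥ z) (fun z => p.2 ⬝ᵥ z) q.1 q.2 then
          ENNReal.ofReal |p.2 ⬝ᵥ q.2 - p.2 ⬝ᵥ q.1| else 0)) := by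
        refine Finset.sum_congr rfl fun q _ => ?_
        have e : ∀ c : Fin n → ℝ, (q.2 - q.1) ⬝ᵥ c = c ⬝ᵥ q.2 - c ⬝ᵥ q.1 := fun c => by
          rw [dotProduct_comm, dotProduct_sub]
        rw [e, e, ENNReal.ofReal_add (abs_nonneg _) (abs_nonneg _)]
        by_cases h : IsLeftEdge V (fun z => p.1 ⬝ᵥ z) (fun z => p.2 ⬝ᵥ z) q.1 q.2 <;>
          simp [h, IsShadowEdge]
    _ ≤ _ := by
        rw [Finset.sum_add_distrib]
        refine (add_le_add h₁ h₂).trans (le_of_eq ?_)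
        have hs : ∀ c : Fin n → ℝ, 0 ≤ ∑ i, |c i| := fun c =>
          Finset.sum_nonneg fun i _ => abs_nonneg _
        have k₁ := mul_nonneg hγ (hs p.1)
        have k₂ := mul_nonneg hγ (hs p.2)
        rw [show (2 : ℝ≥0∞) = ENNReal.ofReal 2 by simp, ← ENNReal.ofReal_mul (by norm_num),
          ← ENNReal.ofReal_mul (by norm_num), ← ENNReal.ofReal_mul (by positivity),
          ← ENNReal.ofReal_add (by linarith) (by linarith), Finset.sum_add_distrib]
        congr 1
        ring

theorem lintegral_isShadowEdge_le (V : Finset (Fin n → ℝ)) {x y : Fin n → ℝ} {δ : ℝ}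
    (hδ : 0 < δ) (hxy : δ ^ 2 ≤ (y - x) ⬝ᵥ (y - x)) :
    ENNReal.ofReal (δ / 2) * ∫⁻ p, {p | IsShadowEdge V p x y}.indicator 1 p ∂gaussianPair n ≤
      ∫⁻ p, ENNReal.ofReal (|(y - x) ⬝ᵥ p.1| + |(y - x) ⬝ᵥ p.2|) *
        {p | IsShadowEdge V p x y}.indicator 1 p ∂gaussianPair n := by
  set r := √((y - x) ⬝ᵥ (y - x)) with hr
  have hrδ : δ ≤ r := Real.le_sqrt_of_sq_le hxy
  have hr0 : 0 < r := hδ.trans_le hrδ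
  have hrr : r * r = (y - x) ⬝ᵥ (y - x) := Real.mul_self_sqrt ((sq_nonneg δ).trans hxy)
  set e := r⁻¹ • (y - x) with he
  have hxe : y - x = r • e := by rw [he, smul_smul, mul_inv_cancel₀ hr0.ne', one_smul]
  have hee : e ⬝ᵥ e = 1 := by
    rw [he, smul_dotProduct, dotProduct_smul, ← hrr, smul_eq_mul, smul_eq_mul]
    field_simp
  have hms := measurableSet_isShadowEdge V x y
  have h := half_lintegral_le hee (measurable_one.indicator hms)
    (f := {p | IsShadowEdge V p x y}.indicator 1)
    (fun p => Set.indicator_le_self' (fun _ _ => zero_le) p) (fun c d => by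
      by_cases hE : IsShadowEdge V (c, d) x y <;>
        simp [hE, isShadowEdge_stretch V (s := √2) (by positivity) hee hxe])
  have hd : δ / 2 = δ * (1 / 2) := by ring
  have hme : Measurable fun x : Fin n → ℝ => e ⬝ᵥ x := by
    unfold dotProduct; fun_prop
  rw [hd, ENNReal.ofReal_mul hδ.le, mul_assoc]
  refine (mul_le_mul_right h _).trans ?_
  have hmI : Measurable ({p | IsShadowEdge V p x y}.indicator (1 : _ × _ → ℝ≥0∞)) :=
    measurable_one.indicator hms
  rw [← lintegral_const_mul _ (by fun_prop)]
  refine lintegral_mono fun p => ?_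
  rw [← mul_assoc, ← ENNReal.ofReal_mul hδ.le]
  refine mul_le_mul_left (ENNReal.ofReal_le_ofReal ?_) _
  have hlen : ∀ c : Fin n → ℝ, |(y - x) ⬝ᵥ c| = r * |e ⬝ᵥ c| := fun c => by
    conv_lhs => rw [hxe, smul_dotProduct, smul_eq_mul, abs_mul, abs_of_pos hr0]
  rw [hlen, hlen, ← mul_add]
  exact mul_le_mul_of_nonneg_right hrδ (by positivity)

theorem lintegral_edgeCount_le (hn : 2 ≤ n) {V : Finset (Fin n → ℝ)} {γ δ : ℝ} (hδ : 0 < δ)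
    (hγ : 0 ≤ γ) (hV₀ : ∀ x ∈ V, ∀ i, 0 ≤ x i) (hV₁ : ∀ x ∈ V, ∀ i, x i ≤ γ)
    (hsep : ∀ x ∈ V, ∀ y ∈ V, x ≠ y → δ ^ 2 ≤ (y - x) ⬝ᵥ (y - x)) :
    ∫⁻ p, edgeCount V p ∂uniformFrame hn ≤ ENNReal.ofReal (32 * n * (γ / δ)) := by
  have hms : ∀ q : (Fin n → ℝ) × (Fin n → ℝ), Measurable
      ({p : (Fin n → ℝ) × (Fin n → ℝ) | IsShadowEdge V p q.1 q.2}.indicator (1 : _ × _ → ℝ≥0∞)) :=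
    fun q => measurable_one.indicator (measurableSet_isShadowEdge V q.1 q.2)
  have hml : ∀ q : (Fin n → ℝ) × (Fin n → ℝ), Measurable fun p : (Fin n → ℝ) × (Fin n → ℝ) =>
      ENNReal.ofReal (|(q.2 - q.1) ⬝ᵥ p.1| + |(q.2 - q.1) ⬝ᵥ p.2|) *
        {p | IsShadowEdge V p q.1 q.2}.indicator 1 p := fun q => by
    refine Measurable.mul ?_ (hms q)
    unfold dotProduct
    fun_prop
  have h₁ : ENNReal.ofReal (δ / 2) * ∫⁻ p, edgeCount V p ∂gaussianPair n ≤
      ENNReal.ofReal (4 * γ) * (ENNReal.ofReal (4 * n) * gaussianPair n Set.univ) := by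
    calc ENNReal.ofReal (δ / 2) * ∫⁻ p, edgeCount V p ∂gaussianPair n
        = ∑ q ∈ V.offDiag, ENNReal.ofReal (δ / 2) *
            ∫⁻ p, {p | IsShadowEdge V p q.1 q.2}.indicator 1 p ∂gaussianPair n := by
          simp only [edgeCount]
          rw [lintegral_finsetSum _ fun q _ => hms q, Finset.mul_sum]
      _ ≤ ∑ q ∈ V.offDiag,
            ∫⁻ p, ENNReal.ofReal (|(q.2 - q.1) ⬝ᵥ p.1| + |(q.2 - q.1) ⬝ᵥ p.2|) *
              {p | IsShadowEdge V p q.1 q.2}.indicator 1 p ∂gaussianPair n := by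
          refine Finset.sum_le_sum fun q hq => ?_
          rw [Finset.mem_offDiag] at hq
          exact lintegral_isShadowEdge_le V hδ (hsep _ hq.1 _ hq.2.1 hq.2.2)
      _ = ∫⁻ p, ∑ q ∈ V.offDiag,
            ENNReal.ofReal (|(q.2 - q.1) ⬝ᵥ p.1| + |(q.2 - q.1) ⬝ᵥ p.2|) *
              {p | IsShadowEdge V p q.1 q.2}.indicator 1 p ∂gaussianPair n :=
          (lintegral_finsetSum _ fun q _ => hml q).symm
      _ ≤ ∫⁻ p, ENNReal.ofReal (4 * γ) * ENNReal.ofReal (∑ i, (|p.1 i| + |p.2 i|))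
            ∂gaussianPair n :=
          lintegral_mono fun p => sum_edge_lengths_le hV₀ hV₁ hγ p
      _ = ENNReal.ofReal (4 * γ) *
            ∫⁻ p, ENNReal.ofReal (∑ i, (|p.1 i| + |p.2 i|)) ∂gaussianPair n :=
          lintegral_const_mul _ (by fun_prop)
      _ ≤ _ := mul_le_mul_right lintegral_abs_sum_le _
  rw [lintegral_gaussianPair_eq_uniformFrame hn (measurable_edgeCount V)
    (fun c d a b k ha hb => edgeCount_triangular V c d k ha hb)] at h₁
  have h₂ : ENNReal.ofReal (δ / 2) * ∫⁻ p, edgeCount V p ∂uniformFrame hn ≤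
      ENNReal.ofReal (4 * γ) * ENNReal.ofReal (4 * n) := by
    refine (ENNReal.mul_le_mul_iff_right gaussianPair_univ_ne_zero
      (gaussianPair_univ_ne_top (n := n))).1 ?_
    calc _ = _ := by ring
      _ ≤ _ := h₁
      _ = _ := by ring
  have hδ₂ : ENNReal.ofReal (δ / 2) ≠ 0 := by
    simpa using hδ
  refine (ENNReal.mul_le_mul_iff_right hδ₂ ENNReal.ofReal_ne_top).1 (h₂.trans (le_of_eq ?_))
  rw [← ENNReal.ofReal_mul (by positivity), ← ENNReal.ofReal_mul (by positivity)]
  congr 1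
  field_simp
  ring

end Bound

end RandomShadow

theorem mainTheorem5 :
    ∃ C : ℝ, 0 < C ∧
      ∀ (m n : ℕ) (hn : 2 ≤ n) (A : Matrix (Fin m) (Fin n) ℝ) (b : Fin m → ℝ) (γ δKM : ℝ),
        Bornology.IsBounded (RandomShadow.standardForm A b) →
        IsGreatest (RandomShadow.nonzeroVertexCoords (RandomShadow.standardForm A b)) γ →
        IsLeast (RandomShadow.nonzeroVertexCoords (RandomShadow.standardForm A b)) δKM →
        AEMeasurable (RandomShadow.shadowSize (RandomShadow.standardForm A b))
            (RandomShadow.uniformFrame hn) ∧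
          ∫⁻ uv, RandomShadow.shadowSize (RandomShadow.standardForm A b) uv
              ∂(RandomShadow.uniformFrame hn) ≤
            ENNReal.ofReal (C * n * (γ / δKM)) := by
  -- `32` comes from the edge count; one more absorbs the additive `1` of `shadowSize_le`, since `1
  -- ≤ n * (γ / δ)`.
  refine ⟨33, by norm_num, fun m n hn A b γ δ hb hγ hδ => ?_⟩
  obtain ⟨hδ₀, v, hv, i, hvi⟩ := hδ.1
  have hδpos : 0 < δ := lt_of_le_of_ne (hvi ▸ hv.1.2 i) (Ne.symm hδ₀)
  have hδγ : δ ≤ γ := hγ.2 hδ.1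
  have hγpos : 0 < γ := hδpos.trans_le hδγ
  set V := (RandomShadow.finite_vertices (A := A) (b := b)).toFinset with hVdef
  have hmem : ∀ x, x ∈ V ↔ x ∈ RandomShadow.vertices (RandomShadow.standardForm A b) := fun x => by
    simp [hVdef]
  have hP : RandomShadow.standardForm A b = convexHull ℝ (V : Set (Fin n → ℝ)) := by
    rw [hVdef, Set.Finite.coe_toFinset, RandomShadow.convexHull_vertices hb]
  have hgen : ∀ x ∈ V, ∀ y ∈ V, ∀ z ∈ V, x ≠ y → x ≠ z → y ≠ z → ∀ s : ℝ,
      z - x ≠ s • (y - x) := fun x hx y hy z hz h₁ h₂ h₃ s =>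
    RandomShadow.extremePoints_not_collinear ((hmem x).1 hx) ((hmem y).1 hy) ((hmem z).1 hz)
      h₁ h₂ h₃ s
  have hV₁ : ∀ x ∈ V, ∀ i, x i ≤ γ := fun x hx i => by
    by_cases h : x i = 0
    · rw [h]; exact hγpos.le
    · exact hγ.2 ⟨h, x, (hmem x).1 hx, i, rfl⟩
  have hcount := RandomShadow.lintegral_edgeCount_le hn hδpos hγpos.le
    (fun x hx i => ((hmem x).1 hx).1.2 i) hV₁ fun x hx y hy hxy =>
      RandomShadow.sq_le_dotProduct_sub hδpos.le hδ.2 ((hmem x).1 hx) ((hmem y).1 hy) hxy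
  rw [hP]
  refine ⟨RandomShadow.aemeasurable_shadowSize hn hgen, ?_⟩
  calc ∫⁻ p, RandomShadow.shadowSize (convexHull ℝ (V : Set (Fin n → ℝ))) p
        ∂(RandomShadow.uniformFrame hn)
      ≤ ∫⁻ p, (1 + RandomShadow.edgeCount V p) ∂(RandomShadow.uniformFrame hn) := by
        refine lintegral_mono_ae ?_
        filter_upwards [RandomShadow.ae_isGeneric_uniformFrame hn hgen] with p hp
          using RandomShadow.shadowSize_le hp
    _ = 1 + ∫⁻ p, RandomShadow.edgeCount V p ∂(RandomShadow.uniformFrame hn) := by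
        rw [lintegral_add_left measurable_const]
        simp
    _ ≤ ENNReal.ofReal 1 + ENNReal.ofReal (32 * n * (γ / δ)) := by
        rw [ENNReal.ofReal_one]
        gcongr
    _ ≤ ENNReal.ofReal (33 * n * (γ / δ)) := by
        have hr : 1 ≤ γ / δ := (one_le_div hδpos).2 hδγ
        have hn' : (2 : ℝ) ≤ n := by exact_mod_cast hn
        rw [← ENNReal.ofReal_add (by norm_num) (by positivity)]
        refine ENNReal.ofReal_le_ofReal ?_
        nlinarith
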